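/- Throughout, $d\ge 1$ and $\|\cdot\|$ is the Euclidean norm on $\mathbb{R}^d$. A measurable $\eta:\mathbb{R}^d\to[0,\infty)$ is an (unnormalised) density of a probability measure $\nu$ on $\mathbb{R}^d$ if $\nu(A)=\int_A\eta\,dx\,/\int_{\mathbb{R}^d}\eta\,dx$ for all Borel sets $A$. Given a factorization $\eta=\eta_0\eta_1$ into measurable functions $\eta_i\ge 0$, the slice sampling kernel moves from $x$ to a new state as follows: draw $t$ uniformly from $(0,\eta_1(x))$, then draw the new state from the distribution whose density is proportional to $y\mapsto\eta_0(y)\mathbb{1}\{\eta_1(y)>t\}$. (This is well defined for $\nu$-almost every $x$; how the kernel is defined at the other points is immaterial.) For $k>0$, $k$-polar slice sampling ($k$-PSS) uses $\eta_0(x)=\|x\|^{k-d}$, $\eta_1(x)=\|x\|^{d-k}\eta(x)$ for $x\ne0$; uniform slice sampling (USS) uses $\eta_0=1$, $\eta_1=\eta$. For a Markov kernel $P$ with invariant distribution $\nu$, put $Pg(x)=\int g(y)\,P(x,dy)$, $\nu(g)=\int g\,d\nu$ and $$\mathsf{gap}_\nu(P)=1-\sup\{\|Pg-\nu(g)\|_{L^2(\nu)}: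 g\in L^2(\nu),\ \|g\|_{L^2(\nu)}\le 1\}.$$ **Theorem.** (i) Let $k,m>0$, let $\chi:\mathbb{S}^{d-1}\to(0,\infty)$ be measurable, and let $\pi$ be a probability measure on $\mathbb{R}^d$ with unnormalised density $\varrho$ satisfying $$\varrho(r\theta)=r^{k-d}\exp(-\chi(\theta)r^m),\qquad r>0,\ \theta\in\mathbb{S}^{d-1}$$ (in particular $\varrho$ is integrable). Let $P$ be the transition kernel of $k$-PSS for $\varrho$. Then $\pi$ is invariant under $P$ and $$\mathsf{gap}_\pi(P)\ge\frac{m}{k+m}.$$ (ii) Let $a\in\mathbb{R}^d$, let $\Sigma\in\mathbb{R}^{d\times d}$ be symmetric positive definite, and let $c>0$. Then $\varrho(x)=c\exp\bigl(-\tfrac12(x-a)^T\Sigma^{-1}(x-a)\bigr)$ is an unnormalised density of the Gaussian distribution $\mathcal{N}(a,\Sigma)$, this distribution is invariant under the transition kernel $P$ of USS for $\varrho$, and $$\mathsf{gap}_{\mathcal{N}(a,\Sigma)}(P)\ge\frac{2}{d+2}.$$ -/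

import Mathlib

open MeasureTheory ProbabilityTheory
open scoped ENNReal

namespace SliceSampling

/-- `ρ : ℝ^d → [0, ∞)` is a (possibly unnormalised) Lebesgue density of `π`:
`π A = (∫_A ρ) / (∫ ρ)` for every Borel set `A`. For a probability measure `π` this forces
`0 < ∫ ρ < ∞`. -/
structure HasUnnormalizedDensity {d : ℕ} (π : Measure (EuclideanSpace ℝ (Fin d)))
    (ρ : EuclideanSpace ℝ (Fin d) → ℝ) : Prop where
  measurable : Measurable ρ
  nonneg : ∀ x, 0 ≤ ρ x
  apply_eq : ∀ A, MeasurableSet A →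
    π A = (∫⁻ x in A, ENNReal.ofReal (ρ x)) / (∫⁻ x, ENNReal.ofReal (ρ x))

/-- The kernel `x ↦ 𝒰((0, η₁ x))`: given the current state `x`, the threshold is drawn uniformly
from the interval `(0, η₁ x)`, i.e. with Lebesgue density `1_{(0, η₁ x)}(t) / η₁ x`. -/
noncomputable def thresholdKernel {d : ℕ} (η₁ : EuclideanSpace ℝ (Fin d) → ℝ) :
    Kernel (EuclideanSpace ℝ (Fin d)) ℝ :=
  Kernel.withDensity (Kernel.const _ volume)
    (fun x t => (Set.Ioo 0 (η₁ x)).indicator 1 t / ENNReal.ofReal (η₁ x))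

/-- The generalised level set function `t ↦ ∫ η₀(x) 𝟙(η₁(x) > t) dx`. -/
noncomputable def levelSetFun {d : ℕ} (η₀ η₁ : EuclideanSpace ℝ (Fin d) → ℝ) (t : ℝ) : ℝ≥0∞ :=
  ∫⁻ x in {x | t < η₁ x}, ENNReal.ofReal (η₀ x)

/-- The `X`-update kernel `t ↦ μ_t`, where `μ_t` has Lebesgue density
`η₀(x) 𝟙(η₁(x) > t) / ∫ η₀(y) 𝟙(η₁(y) > t) dy`. -/
noncomputable def updateKernel {d : ℕ} (η₀ η₁ : EuclideanSpace ℝ (Fin d) → ℝ) :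
    Kernel ℝ (EuclideanSpace ℝ (Fin d)) :=
  Kernel.withDensity (Kernel.const _ volume)
    (fun t x => {x | t < η₁ x}.indicator (fun x => ENNReal.ofReal (η₀ x)) x / levelSetFun η₀ η₁ t)

/-- One step of slice sampling: draw the threshold `t`, then draw the new state from `μ_t`. -/
noncomputable def stepKernel {d : ℕ} (η₀ η₁ : EuclideanSpace ℝ (Fin d) → ℝ) :
    Kernel (EuclideanSpace ℝ (Fin d)) (EuclideanSpace ℝ (Fin d)) :=
  (updateKernel η₀ η₁).comp (thresholdKernel η₁)

theorem measurableSet_wellDefined {d : ℕ} (η₀ η₁ : EuclideanSpace ℝ (Fin d) → ℝ) :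
    MeasurableSet {x | stepKernel η₀ η₁ x Set.univ = 1} :=
  (Kernel.measurable_coe _ MeasurableSet.univ) (measurableSet_singleton 1)

open Classical in
/-- The transition kernel of slice sampling with factors `η₀, η₁`. At the states `x` from which the
above step is not well defined (`η₁ x = 0`, or slices of mass `0` or `∞`, which form a null set of
the target) the chain stays put, so that this is always a Markov kernel. -/
noncomputable def sliceKernel {d : ℕ} (η₀ η₁ : EuclideanSpace ℝ (Fin d) → ℝ) :
    Kernel (EuclideanSpace ℝ (Fin d)) (EuclideanSpace ℝ (Fin d)) :=
  Kernel.piecewise (measurableSet_wellDefined η₀ η₁) (stepKernel η₀ η₁) Kernel.id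

instance {d : ℕ} (η₀ η₁ : EuclideanSpace ℝ (Fin d) → ℝ) : IsMarkovKernel (sliceKernel η₀ η₁) := by
  refine ⟨fun x => ⟨?_⟩⟩
  classical
  unfold sliceKernel
  rw [Kernel.piecewise_apply']
  split_ifs with h
  · exact h
  · simp [Kernel.id_apply]

/-- `k`-polar slice sampling for the target density `η`: slice sampling with the factors
`η₀ x = ‖x‖ ^ (k - d)` and `η₁ x = ‖x‖ ^ (d - k) * η x`. -/
noncomputable def polarSliceKernel {d : ℕ} (k : ℝ) (η : EuclideanSpace ℝ (Fin d) → ℝ) :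
    Kernel (EuclideanSpace ℝ (Fin d)) (EuclideanSpace ℝ (Fin d)) :=
  sliceKernel (fun x => ‖x‖ ^ (k - d)) (fun x => ‖x‖ ^ (d - k) * η x)

/-- Uniform slice sampling for the target density `η`: slice sampling with the factors
`η₀ = 1` and `η₁ = η`. -/
noncomputable def uniformSliceKernel {d : ℕ} (η : EuclideanSpace ℝ (Fin d) → ℝ) :
    Kernel (EuclideanSpace ℝ (Fin d)) (EuclideanSpace ℝ (Fin d)) :=
  sliceKernel (fun _ => 1) η

/-- The norm of the operator `g ↦ P g - ν(g)` on `L²(ν)`, as an extended nonnegative number. -/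
noncomputable def deviationNorm {G : Type*} [MeasurableSpace G] (ν : Measure G)
    (P : Kernel G G) : ℝ≥0∞ :=
  ⨆ (g : G → ℝ) (_ : MemLp g 2 ν) (_ : eLpNorm g 2 ν ≤ 1),
    eLpNorm (fun x => (∫ y, g y ∂(P x)) - ∫ y, g y ∂ν) 2 ν

/-- The `L²`-spectral gap `1 - ‖P - ν‖` of a Markov kernel `P` with invariant distribution `ν`. -/
noncomputable def spectralGap {G : Type*} [MeasurableSpace G] (ν : Measure G)
    (P : Kernel G G) : EReal :=
  1 - (deviationNorm ν P : EReal)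

end SliceSampling

/-! Write `η₁ = c * exp (-V)`. From `x` the threshold is `t = c * exp (-V x) * u` with `u` uniform
on `(0, 1)`, so `log (c / t) = V x - log u`, and the slice `{t < η₁}` is the sublevel set `{V < log
(c / t)}`. If `{V < w}` has `η₀`-mass `C * w ^ α`, the potential of the new state is `log (c / t) *
s ^ (1 / α)` with `s` uniform and independent. Thus `V` evolves as a Markov chain on its own, by `v
↦ (v + E) * s ^ (1 / α)` with `E` exponential. Using the same `E` and `s` from two starting points
contracts their mean distance by `r = α / (α + 1)`, the mean of `s ^ (1 / α)`.

Contraction of Lipschitz constants becomes an `L²` bound as follows. One step turns a bounded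
function into a Lipschitz function of `V` (`abs_average_sub_le`), and every further step multiplies
the Lipschitz constant by `r` (`abs_rescale_sub_le`). As `V` is square integrable, a centred bounded
`f` satisfies `‖P^n f‖² ≤ K * r ^ (2 n)`, with `K` depending on `f`. Reversibility makes `n ↦ ‖P^n
f‖²` log-convex, so its successive ratios cannot decrease; the decay rate therefore already bounds
the first ratio, and `K` disappears: `‖P f‖ ≤ r ‖f‖` (`le_mul_of_logConvex`). Density of bounded
functions gives the bound on all of `L²`, and the gap is at least `1 - r = 1 / (α + 1)`.

Both cases of the theorem have a potential that is homogeneous of degree `m`, in the second case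
after a translation. As the measure with density `‖x‖ ^ (k - d)` is homogeneous of degree `k`, this
gives `α = k / m`; uniform slice sampling of a Gaussian has `k = d` and `m = 2`. -/

namespace SliceSampling

/-! ### Reversible Markov operators: from decay rates to `L²` norm bounds -/

section MarkovOperator

variable {G : Type*} [MeasurableSpace G]

/-- The Markov operator `f ↦ P f` of a kernel. -/
noncomputable def markovOp (P : Kernel G G) (f : G → ℝ) (x : G) : ℝ := ∫ y, f y ∂(P x)

/-- Bounded measurable functions. -/
structure IsBddMeasurable (f : G → ℝ) : Prop where
  measurable : Measurable f
  bounded : ∃ M, 0 ≤ M ∧ ∀ x, |f x| ≤ M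

namespace IsBddMeasurable

variable {f g : G → ℝ}

lemma memLp (hf : IsBddMeasurable f) (p : ℝ≥0∞) (μ : Measure G) [IsFiniteMeasure μ] :
    MemLp f p μ := by
  obtain ⟨M, -, hM⟩ := hf.bounded
  exact MemLp.of_bound hf.measurable.aestronglyMeasurable M (.of_forall hM)

lemma integrable (hf : IsBddMeasurable f) (μ : Measure G) [IsFiniteMeasure μ] :
    Integrable f μ :=
  memLp_one_iff_integrable.1 (hf.memLp 1 μ)

lemma sub_const (hf : IsBddMeasurable f) (a : ℝ) : IsBddMeasurable (fun x => f x - a) := by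
  obtain ⟨M, hM0, hM⟩ := hf.bounded
  exact ⟨hf.measurable.sub_const a, M + |a|, by positivity,
    fun x => (abs_sub _ _).trans (by gcongr; exact hM x)⟩

lemma mul (hf : IsBddMeasurable f) (hg : IsBddMeasurable g) :
    IsBddMeasurable (fun x => f x * g x) := by
  obtain ⟨M, hM0, hM⟩ := hf.bounded
  obtain ⟨N, hN0, hN⟩ := hg.bounded
  refine ⟨hf.measurable.mul hg.measurable, M * N, by positivity, fun x => ?_⟩
  rw [abs_mul]
  exact mul_le_mul (hM x) (hN x) (abs_nonneg _) hM0

lemma abs_integral_le {M : ℝ} (hM0 : 0 ≤ M) (hM : ∀ x, |f x| ≤ M) (μ : Measure G)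
    (hμ : μ Set.univ ≤ 1) : |∫ x, f x ∂μ| ≤ M := by
  have : IsFiniteMeasure μ := ⟨hμ.trans_lt ENNReal.one_lt_top⟩
  have h := norm_integral_le_of_norm_le_const (μ := μ) (f := f) (C := M) (.of_forall hM)
  refine h.trans (mul_le_of_le_one_right hM0 ?_)
  rw [Measure.real]
  exact ENNReal.toReal_le_of_le_ofReal zero_le_one (by simpa using hμ)

lemma markovOp (hf : IsBddMeasurable f) (P : Kernel G G) [IsMarkovKernel P] :
    IsBddMeasurable (markovOp P f) := by
  obtain ⟨M, hM0, hM⟩ := hf.bounded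
  exact ⟨hf.measurable.stronglyMeasurable.integral_kernel.measurable, M, hM0,
    fun x => abs_integral_le hM0 hM _ (by simp)⟩

lemma iterate_markovOp (hf : IsBddMeasurable f) (P : Kernel G G) [IsMarkovKernel P] (n : ℕ) :
    IsBddMeasurable ((SliceSampling.markovOp P)^[n] f) := by
  induction n with
  | zero => exact hf
  | succ n ih => rw [Function.iterate_succ_apply']; exact ih.markovOp P

end IsBddMeasurable

variable {ν : Measure G} {P : Kernel G G}

/-- Invariance makes a `ν`-null set `P x`-null for `ν`-almost every `x`, so the operator acts on
almost-everywhere classes. -/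
lemma markovOp_ae_congr (hP : P.Invariant ν) {f g : G → ℝ} (h : f =ᵐ[ν] g) :
    markovOp P f =ᵐ[ν] markovOp P g := by
  rw [← hP.def] at h
  filter_upwards [Measure.ae_ae_of_ae_comp h] with x hx using integral_congr_ae hx

lemma integral_markovOp [IsFiniteMeasure ν] [IsMarkovKernel P] (hP : P.Invariant ν) {f : G → ℝ}
    (hf : Integrable f ν) : ∫ x, markovOp P f x ∂ν = ∫ x, f x ∂ν := by
  have h := Kernel.integral_comp (κ := Kernel.const Unit ν) (η := P) (a := ()) (f := f)
    (by rwa [← Measure.comp_eq_comp_const_apply, hP.def])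
  rw [← Measure.comp_eq_comp_const_apply, hP.def] at h
  exact h.symm

/-- A Markov operator is a contraction on `L²` of an invariant measure. -/
lemma eLpNorm_markovOp_le [IsMarkovKernel P] (hP : P.Invariant ν) {f : G → ℝ}
    (hf : AEStronglyMeasurable f ν) : eLpNorm (markovOp P f) 2 ν ≤ eLpNorm f 2 ν := by
  obtain ⟨g, hg, hfg⟩ := hf
  rw [eLpNorm_congr_ae hfg, eLpNorm_congr_ae (markovOp_ae_congr hP hfg),
    eLpNorm_eq_lintegral_rpow_enorm_toReal two_ne_zero ENNReal.ofNat_ne_top,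
    eLpNorm_eq_lintegral_rpow_enorm_toReal two_ne_zero ENNReal.ofNat_ne_top]
  refine ENNReal.rpow_le_rpow ?_ (by positivity)
  have hmeas : Measurable fun x => ‖g x‖ₑ ^ (2 : ℝ≥0∞).toReal := by fun_prop
  calc ∫⁻ x, ‖markovOp P g x‖ₑ ^ (2 : ℝ≥0∞).toReal ∂ν
      ≤ ∫⁻ x, ∫⁻ y, ‖g y‖ₑ ^ (2 : ℝ≥0∞).toReal ∂(P x) ∂ν := by
        refine lintegral_mono fun x => ?_
        have h := eLpNorm_le_eLpNorm_of_exponent_le (p := 1) (q := 2) (μ := P x)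
          (by norm_num) hg.aestronglyMeasurable
        rw [eLpNorm_one_eq_lintegral_enorm,
          eLpNorm_eq_lintegral_rpow_enorm_toReal two_ne_zero ENNReal.ofNat_ne_top] at h
        refine (ENNReal.rpow_le_rpow ((enorm_integral_le_lintegral_enorm _).trans h)
          (by positivity)).trans_eq ?_
        rw [← ENNReal.rpow_mul]
        simp
    _ = ∫⁻ y, ‖g y‖ₑ ^ (2 : ℝ≥0∞).toReal ∂ν := by
        rw [← Measure.lintegral_bind P.aemeasurable hmeas.aemeasurable, hP.def]

/-- The Markov operator of a reversible kernel is symmetric. -/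
lemma integral_markovOp_mul [IsFiniteMeasure ν] [IsMarkovKernel P] (hP : P.IsReversible ν)
    {f g : G → ℝ} (hf : IsBddMeasurable f) (hg : IsBddMeasurable g) :
    ∫ x, markovOp P f x * g x ∂ν = ∫ x, f x * markovOp P g x ∂ν := by
  -- Reversibility says that two consecutive states form an exchangeable pair; rectangles suffice to
  -- identify the joint law.
  have hswap : (ν ⊗ₘ P).map Prod.swap = ν ⊗ₘ P := by
    refine Measure.ext_prod fun {s t} hs ht => ?_
    rw [Measure.map_apply measurable_swap (hs.prod ht), Set.preimage_swap_prod,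
      Measure.compProd_apply_prod ht hs, Measure.compProd_apply_prod hs ht]
    exact hP ht hs
  have hfst {h : G → ℝ} (hh : IsBddMeasurable h) : IsBddMeasurable fun p : G × G => h p.1 :=
    ⟨hh.measurable.comp measurable_fst, hh.bounded.imp fun M hM => ⟨hM.1, fun p => hM.2 _⟩⟩
  have hsnd {h : G → ℝ} (hh : IsBddMeasurable h) : IsBddMeasurable fun p : G × G => h p.2 :=
    ⟨hh.measurable.comp measurable_snd, hh.bounded.imp fun M hM => ⟨hM.1, fun p => hM.2 _⟩⟩
  have h1 := Measure.integral_compProd (((hsnd hf).mul (hfst hg)).integrable (ν ⊗ₘ P))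
  have h2 := Measure.integral_compProd (((hfst hf).mul (hsnd hg)).integrable (ν ⊗ₘ P))
  simp only [integral_mul_const, integral_const_mul] at h1 h2
  change _ = ∫ x, markovOp P f x * g x ∂ν at h1
  change _ = ∫ x, f x * markovOp P g x ∂ν at h2
  rw [← h1, ← h2]
  conv_lhs => rw [← hswap]
  rw [integral_map measurable_swap.aemeasurable
    ((hsnd hf).mul (hfst hg)).measurable.aestronglyMeasurable]
  rfl

/-- Cauchy–Schwarz for bounded measurable functions. -/
lemma sq_integral_mul_le [IsFiniteMeasure ν] {f g : G → ℝ} (hf : IsBddMeasurable f)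
    (hg : IsBddMeasurable g) :
    (∫ x, f x * g x ∂ν) ^ 2 ≤ (∫ x, f x ^ 2 ∂ν) * ∫ x, g x ^ 2 ∂ν := by
  have hff := (hf.mul hf).integrable ν
  have hfg := (hf.mul hg).integrable ν
  have hgg := (hg.mul hg).integrable ν
  -- The quadratic `t ↦ ∫ (t f + g)²` is nonnegative, so its discriminant is nonpositive.
  have key : ∀ t : ℝ, 0 ≤ (∫ x, f x ^ 2 ∂ν) * (t * t) + (2 * ∫ x, f x * g x ∂ν) * t
      + ∫ x, g x ^ 2 ∂ν := fun t => by
    have : ∫ x, (t * f x + g x) ^ 2 ∂ν = (∫ x, f x ^ 2 ∂ν) * (t * t)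
        + (2 * ∫ x, f x * g x ∂ν) * t + ∫ x, g x ^ 2 ∂ν := by
      simp_rw [pow_two (f _), pow_two (g _)]
      have h1 : Integrable (fun x => f x * f x * (t * t)) ν := hff.mul_const _
      have h2 : Integrable (fun x => 2 * (f x * g x) * t) ν := (hfg.const_mul 2).mul_const t
      have h12 : Integrable (fun x => f x * f x * (t * t) + 2 * (f x * g x) * t) ν := h1.add h2
      rw [← integral_mul_const, ← integral_const_mul, ← integral_mul_const,
        ← integral_add h1 h2, ← integral_add h12 hgg]
      exact integral_congr_ae (.of_forall fun x => by ring)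
    rw [← this]
    exact integral_nonneg fun x => sq_nonneg _
  have := discrim_le_zero key
  rw [discrim] at this
  linarith

/-- A log-convex sequence which is `O(r ^ n)` decreases in its first step by the factor `r`. -/
lemma le_mul_of_logConvex {b : ℕ → ℝ} {r K : ℝ} (hr : 0 < r) (hb : ∀ n, 0 ≤ b n)
    (hconv : ∀ n, b (n + 1) ^ 2 ≤ b n * b (n + 2)) (hK : ∀ n, b n ≤ K * r ^ n) :
    b 1 ≤ r * b 0 := by
  by_contra! h
  have h1 : 0 < b 1 := (mul_nonneg hr.le (hb 0)).trans_lt h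
  have h0 : 0 < b 0 := by
    refine (hb 0).lt_of_ne fun h0 => ?_
    have := hconv 0
    rw [← h0, zero_mul] at this
    exact (pow_pos h1 2).not_ge this
  -- Log-convexity makes the ratios `b (n + 1) / b n` nondecreasing, so an initial ratio `q > r`
  -- forces growth at least like `q ^ n`, against the `O(r ^ n)` bound.
  set q := b 1 / b 0 with hq
  have hqr : r < q := by rwa [hq, lt_div_iff₀ h0]
  have hq0 : 0 < q := hr.trans hqr
  have hstep : ∀ n, 0 < b n ∧ q * b n ≤ b (n + 1) := fun n => by
    induction n with
    | zero => exact ⟨h0, (div_mul_cancel₀ _ h0.ne').le⟩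
    | succ n ih =>
      have hpos : 0 < b (n + 1) := (mul_pos hq0 ih.1).trans_le ih.2
      refine ⟨hpos, le_of_mul_le_mul_left ?_ ih.1⟩
      calc b n * (q * b (n + 1)) = q * b n * b (n + 1) := by ring
        _ ≤ b (n + 1) * b (n + 1) := by gcongr; exact ih.2
        _ ≤ b n * b (n + 2) := by rw [← pow_two]; exact hconv n
  have hlow : ∀ n, b 0 * q ^ n ≤ b n := fun n => by
    induction n with
    | zero => simp
    | succ n ih =>
      calc b 0 * q ^ (n + 1) = q * (b 0 * q ^ n) := by ring
        _ ≤ q * b n := by gcongr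
        _ ≤ _ := (hstep n).2
  have hlim := tendsto_pow_atTop_atTop_of_one_lt ((one_lt_div hr).2 hqr)
  obtain ⟨n, hn⟩ := (hlim.eventually_gt_atTop (K / b 0)).exists
  rw [div_pow, div_lt_div_iff₀ h0 (by positivity)] at hn
  have := (hlow n).trans (hK n)
  linarith

/-- For a reversible kernel, geometric convergence of all centred bounded functions with a common
rate, but without any uniformity in the constants, is an `L²` contraction with that rate. -/
theorem integral_markovOp_sq_le [IsFiniteMeasure ν] [IsMarkovKernel P] (hP : P.IsReversible ν)
    {f : G → ℝ} (hf : IsBddMeasurable f) {r K : ℝ} (hr : 0 < r)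
    (hK : ∀ n, ∫ x, ((markovOp P)^[n] f x) ^ 2 ∂ν ≤ K * r ^ n) :
    ∫ x, (markovOp P f x) ^ 2 ∂ν ≤ r * ∫ x, f x ^ 2 ∂ν := by
  refine le_mul_of_logConvex (b := fun n => ∫ x, ((markovOp P)^[n] f x) ^ 2 ∂ν) hr
    (fun n => integral_nonneg fun x => sq_nonneg _) (fun n => ?_) hK
  have hn := hf.iterate_markovOp P n
  have hn1 := hf.iterate_markovOp P (n + 1)
  have hn2 := hf.iterate_markovOp P (n + 2)
  -- Symmetry gives `‖P^(n+1) f‖² = ⟨P^n f, P^(n+2) f⟩`; Cauchy–Schwarz then yields log-convexity.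
  have h := integral_markovOp_mul hP hn hn1
  simp only [← Function.iterate_succ_apply' (markovOp P)] at h
  simp only [pow_two (((markovOp P)^[n + 1] f) _)]
  rw [h]
  exact sq_integral_mul_le hn hn2

lemma eLpNorm_two_eq_ofReal_sqrt [IsFiniteMeasure ν] {f : G → ℝ} (hf : IsBddMeasurable f) :
    eLpNorm f 2 ν = ENNReal.ofReal (√(∫ x, f x ^ 2 ∂ν)) := by
  rw [(hf.memLp 2 ν).eLpNorm_eq_integral_rpow_norm two_ne_zero ENNReal.ofNat_ne_top,
    Real.sqrt_eq_rpow]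
  simp

/-- For a reversible kernel, geometric convergence of all centred bounded functions with a common
rate bounds the `L²` operator norm of the deviation from equilibrium. -/
theorem deviationNorm_le [IsProbabilityMeasure ν] [IsMarkovKernel P] (hP : P.IsReversible ν)
    {r : ℝ} (hr : 0 < r)
    (hdecay : ∀ f, IsBddMeasurable f → ∫ x, f x ∂ν = 0 →
      ∃ K, ∀ n, ∫ x, ((markovOp P)^[n] f x) ^ 2 ∂ν ≤ K * (r ^ 2) ^ n) :
    deviationNorm ν P ≤ ENNReal.ofReal r := by
  have hinv : P.Invariant ν := hP.invariant
  have hbdd : ∀ f, IsBddMeasurable f →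
      eLpNorm (fun x => markovOp P f x - ∫ y, f y ∂ν) 2 ν ≤ ENNReal.ofReal r * eLpNorm f 2 ν := by
    intro f hf
    set a := ∫ y, f y ∂ν with ha
    have hfa := hf.sub_const a
    have hsub : (fun x => markovOp P f x - a) = markovOp P fun x => f x - a := by
      ext x
      simp [markovOp, integral_sub (hf.integrable (P x)) (integrable_const a)]
    have hcent : ∫ x, f x - a ∂ν = 0 := by
      rw [integral_sub (hf.integrable ν) (integrable_const a)]
      simp [ha]
    obtain ⟨K, hK⟩ := hdecay _ hfa hcent
    have h := integral_markovOp_sq_le hP hfa (by positivity) hK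
    have hle : ∫ x, (f x - a) ^ 2 ∂ν ≤ ∫ x, f x ^ 2 ∂ν := by
      have hff : Integrable (fun x => f x ^ 2) ν := by
        simpa only [pow_two] using (hf.mul hf).integrable ν
      have : ∫ x, (f x - a) ^ 2 ∂ν = ∫ x, f x ^ 2 ∂ν - 2 * a * a + a ^ 2 := by
        have hi : Integrable (fun x => 2 * a * f x) ν := (hf.integrable ν).const_mul (2 * a)
        have hfi : Integrable (fun x => f x ^ 2 - 2 * a * f x) ν := hff.sub hi
        calc ∫ x, (f x - a) ^ 2 ∂ν = ∫ x, (f x ^ 2 - 2 * a * f x + a ^ 2) ∂ν :=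
              integral_congr_ae (.of_forall fun x => by ring)
          _ = _ := by
              rw [integral_add hfi (integrable_const _), integral_sub hff hi,
                integral_const_mul]
              simp [ha]
      nlinarith [sq_nonneg a]
    rw [hsub, eLpNorm_two_eq_ofReal_sqrt (hfa.markovOp P), eLpNorm_two_eq_ofReal_sqrt hf,
      ← ENNReal.ofReal_mul hr.le]
    refine ENNReal.ofReal_le_ofReal (Real.sqrt_le_iff.2 ⟨by positivity, ?_⟩)
    rw [mul_pow, Real.sq_sqrt (integral_nonneg fun x => sq_nonneg _)]
    exact h.trans (by gcongr)
  refine iSup_le fun g => iSup_le fun hg => iSup_le fun hg1 => ?_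
  refine ENNReal.le_of_forall_pos_le_add fun ε hε _ => ?_
  -- With `e = ‖g - s‖`, the approximation costs `r * e` from `‖s‖ ≤ 1 + e`, and `e` each from `P (g
  -- - s)` and from the mean of `g - s`; hence the denominator `2 + r`.
  have hε2 : (0 : ℝ≥0∞) < ε / (2 + ENNReal.ofReal r) :=
    ENNReal.div_pos (by exact_mod_cast hε.ne') (by finiteness)
  obtain ⟨s, hs, hsb⟩ : ∃ s : G → ℝ,
      eLpNorm (g - s) 2 ν < ε / (2 + ENNReal.ofReal r) ∧ IsBddMeasurable s := by
    obtain ⟨s, hs, -⟩ := hg.exists_simpleFunc_eLpNorm_sub_lt ENNReal.ofNat_ne_top hε2.ne'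
    obtain ⟨M, hM⟩ := s.exists_forall_norm_le
    exact ⟨s, hs, s.measurable, max M 0, le_max_right _ _,
      fun x => (hM x).trans (le_max_left _ _)⟩
  have hgi : Integrable g ν := hg.integrable one_le_two
  have hsi : Integrable s ν := hsb.integrable ν
  have hdi : Integrable (g - s) ν := hgi.sub hsi
  have hsplit : (fun x => (∫ y, g y ∂P x) - ∫ y, g y ∂ν) =ᵐ[ν]
      (fun x => markovOp P s x - ∫ y, s y ∂ν)
        + (markovOp P (g - s) - fun _ => ∫ y, (g - s) y ∂ν) := by
    have hae : ∀ᵐ x ∂ν, Integrable g (P x) :=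
      Measure.ae_integrable_of_integrable_comp (by rwa [hinv.def])
    filter_upwards [hae] with x hx
    simp only [Pi.add_apply, Pi.sub_apply, markovOp]
    rw [integral_sub hx (hsb.integrable _), integral_sub hgi hsi]
    ring
  have hmP {f : G → ℝ} (hf : AEStronglyMeasurable f ν) :
      AEStronglyMeasurable (markovOp P f) ν :=
    AEStronglyMeasurable.integral_kernel_comp (κ := Kernel.const Unit ν) (a := ()) (η := P)
      (by rwa [← Measure.comp_eq_comp_const_apply, hinv.def])
  have hconst : eLpNorm (fun _ : G => ∫ y, (g - s) y ∂ν) 2 ν ≤ eLpNorm (g - s) 2 ν := by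
    rw [eLpNorm_const _ two_ne_zero (IsProbabilityMeasure.ne_zero ν)]
    simp only [measure_univ, ENNReal.one_rpow, mul_one]
    refine (enorm_integral_le_lintegral_enorm _).trans ?_
    rw [← eLpNorm_one_eq_lintegral_enorm]
    exact eLpNorm_le_eLpNorm_of_exponent_le (by norm_num) hdi.1
  have hslt : eLpNorm s 2 ν ≤ 1 + eLpNorm (g - s) 2 ν := by
    have : s = g - (g - s) := by simp
    calc eLpNorm s 2 ν = eLpNorm (g - (g - s)) 2 ν := by rw [← this]
      _ ≤ eLpNorm g 2 ν + eLpNorm (g - s) 2 ν := eLpNorm_sub_le hg.1 hdi.1 (by norm_num)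
      _ ≤ _ := by gcongr
  have hmain : eLpNorm (fun x => markovOp P s x - ∫ y, s y ∂ν) 2 ν
      ≤ ENNReal.ofReal r * (1 + eLpNorm (g - s) 2 ν) :=
    (hbdd s hsb).trans (mul_le_mul_right hslt _)
  have hrest : eLpNorm (markovOp P (g - s) - fun _ => ∫ y, (g - s) y ∂ν) 2 ν
      ≤ eLpNorm (g - s) 2 ν + eLpNorm (g - s) 2 ν :=
    (eLpNorm_sub_le (hmP hdi.1) aestronglyMeasurable_const (by norm_num)).trans
      (add_le_add (eLpNorm_markovOp_le hinv hdi.1) hconst)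
  rw [eLpNorm_congr_ae hsplit]
  refine (eLpNorm_add_le ((hmP hsb.measurable.aestronglyMeasurable).sub aestronglyMeasurable_const)
    ((hmP hdi.1).sub aestronglyMeasurable_const) (by norm_num)).trans ?_
  refine (add_le_add hmain hrest).trans ?_
  have hle := (ENNReal.le_div_iff_mul_le (.inl (by simp)) (.inr ENNReal.coe_ne_top)).1 hs.le
  refine le_trans (le_of_eq ?_) (add_le_add_right hle (ENNReal.ofReal r))
  generalize eLpNorm (g - s) 2 ν = e
  ring

end MarkovOperator

/-! ### Slice sampling kernels and their reversibility -/

section Slices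

variable {d : ℕ} {η₀ η₁ : EuclideanSpace ℝ (Fin d) → ℝ}

/-- The measure with Lebesgue density `η₀`. -/
noncomputable def refMeasure (η₀ : EuclideanSpace ℝ (Fin d) → ℝ) :
    Measure (EuclideanSpace ℝ (Fin d)) :=
  volume.withDensity fun x => ENNReal.ofReal (η₀ x)

instance : SigmaFinite (refMeasure η₀) := by unfold refMeasure; infer_instance

lemma measurableSet_slices (hη₁ : Measurable η₁) :
    MeasurableSet {p : ℝ × EuclideanSpace ℝ (Fin d) | p.1 < η₁ p.2} :=
  measurableSet_lt measurable_fst (hη₁.comp measurable_snd)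

lemma measurableSet_slice (hη₁ : Measurable η₁) (t : ℝ) : MeasurableSet {x | t < η₁ x} :=
  measurableSet_lt measurable_const hη₁

lemma levelSetFun_eq (hη₁ : Measurable η₁) (t : ℝ) :
    levelSetFun η₀ η₁ t = refMeasure η₀ {x | t < η₁ x} := by
  rw [levelSetFun, refMeasure, withDensity_apply _ (measurableSet_slice hη₁ t)]

lemma measurable_refMeasure_slice_inter (hη₁ : Measurable η₁) {B : Set (EuclideanSpace ℝ (Fin d))}
    (hB : MeasurableSet B) : Measurable fun t => refMeasure η₀ (B ∩ {x | t < η₁ x}) :=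
  measurable_measure_prodMk_left ((measurable_snd hB).inter (measurableSet_slices hη₁))

lemma measurable_levelSetFun (hη₁ : Measurable η₁) : Measurable (levelSetFun η₀ η₁) := by
  simp_rw [funext (levelSetFun_eq (η₀ := η₀) hη₁)]
  simpa using measurable_refMeasure_slice_inter (η₀ := η₀) hη₁ MeasurableSet.univ

lemma updateKernel_apply (hη₀ : Measurable η₀) (hη₁ : Measurable η₁) (t : ℝ) :
    updateKernel η₀ η₁ t
      = (levelSetFun η₀ η₁ t)⁻¹ • (refMeasure η₀).restrict {x | t < η₁ x} := by
  have hmeas : Measurable (Function.uncurry fun (t : ℝ) (x : EuclideanSpace ℝ (Fin d)) =>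
      {x | t < η₁ x}.indicator (fun x => ENNReal.ofReal (η₀ x)) x / levelSetFun η₀ η₁ t) := by
    refine Measurable.div ?_ ((measurable_levelSetFun hη₁).comp measurable_fst)
    exact ((hη₀.comp measurable_snd).ennreal_ofReal).indicator (measurableSet_slices hη₁)
  rw [updateKernel, Kernel.withDensity_apply _ hmeas, Kernel.const_apply, refMeasure,
    restrict_withDensity (measurableSet_slice hη₁ t),
    ← withDensity_indicator (measurableSet_slice hη₁ t),
    ← withDensity_smul _ (hη₀.ennreal_ofReal.indicator (measurableSet_slice hη₁ t))]
  congr 1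
  ext x
  simp [div_eq_mul_inv, mul_comm]

/-- The inequality covers levels of mass `0` or `∞`, where the update has total mass `0`, so the
update is a finite kernel without exceptional thresholds. -/
lemma updateKernel_apply_univ_le (hη₀ : Measurable η₀) (hη₁ : Measurable η₁) (t : ℝ) :
    updateKernel η₀ η₁ t Set.univ ≤ 1 := by
  simp only [updateKernel_apply hη₀ hη₁, Measure.smul_apply, Measure.restrict_apply_univ,
    ← levelSetFun_eq hη₁, smul_eq_mul]
  exact ENNReal.inv_mul_le_one _

lemma thresholdKernel_apply (hη₁ : Measurable η₁) (x : EuclideanSpace ℝ (Fin d)) :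
    thresholdKernel η₁ x
      = (ENNReal.ofReal (η₁ x))⁻¹ • volume.restrict (Set.Ioo 0 (η₁ x)) := by
  have hmeas : Measurable (Function.uncurry fun (x : EuclideanSpace ℝ (Fin d)) (t : ℝ) =>
      (Set.Ioo 0 (η₁ x)).indicator (1 : ℝ → ℝ≥0∞) t / ENNReal.ofReal (η₁ x)) := by
    refine Measurable.div ?_ (hη₁.comp measurable_fst).ennreal_ofReal
    exact measurable_one.indicator ((measurableSet_lt measurable_const measurable_snd).inter
      (measurableSet_lt measurable_snd (hη₁.comp measurable_fst)))
  rw [thresholdKernel, Kernel.withDensity_apply _ hmeas, Kernel.const_apply,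
    ← withDensity_indicator_one measurableSet_Ioo,
    ← withDensity_smul _ (measurable_one.indicator measurableSet_Ioo)]
  congr 1
  ext t
  simp [div_eq_mul_inv, mul_comm]

/-- A uniform variable on `(0, b)` is `b` times a uniform variable on `(0, 1)`. -/
lemma smul_restrict_Ioo_eq_map {b : ℝ} (hb : 0 < b) :
    (ENNReal.ofReal b)⁻¹ • volume.restrict (Set.Ioo 0 b)
      = (volume.restrict (Set.Ioo (0 : ℝ) 1)).map (b * ·) := by
  have h := Real.smul_map_volume_mul_left hb.ne'
  rw [abs_of_pos hb] at h
  conv_lhs => rw [← h]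
  rw [Measure.restrict_smul, smul_smul, ENNReal.inv_mul_cancel (by simpa) ENNReal.ofReal_ne_top,
    one_smul, Measure.restrict_map (measurable_const_mul b) measurableSet_Ioo]
  congr 2
  ext u
  simp only [Set.mem_preimage, Set.mem_Ioo, mul_pos_iff_of_pos_left hb]
  exact and_congr_right fun _ => by rw [mul_lt_iff_lt_one_right hb]

lemma stepKernel_apply (hη₁ : Measurable η₁) {x : EuclideanSpace ℝ (Fin d)}
    {B : Set (EuclideanSpace ℝ (Fin d))} (hB : MeasurableSet B) :
    stepKernel η₀ η₁ x B = (ENNReal.ofReal (η₁ x))⁻¹ *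
      ∫⁻ t in Set.Ioo 0 (η₁ x), updateKernel η₀ η₁ t B := by
  rw [stepKernel, Kernel.comp_apply' _ _ _ hB, thresholdKernel_apply hη₁, lintegral_smul_measure,
    smul_eq_mul]

/-- The step is well defined at `x` if almost all slices below `η₁ x` have finite positive mass. -/
lemma sliceKernel_apply (hη₀ : Measurable η₀) (hη₁ : Measurable η₁)
    {x : EuclideanSpace ℝ (Fin d)} (hx : 0 < η₁ x)
    (hlevel : ∀ t ∈ Set.Ioo 0 (η₁ x), levelSetFun η₀ η₁ t ≠ 0 ∧ levelSetFun η₀ η₁ t ≠ ∞) :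
    sliceKernel η₀ η₁ x = stepKernel η₀ η₁ x := by
  have h : stepKernel η₀ η₁ x Set.univ = 1 := by
    rw [stepKernel_apply hη₁ MeasurableSet.univ, setLIntegral_congr_fun (g := 1) measurableSet_Ioo]
    · simpa using ENNReal.inv_mul_cancel (by simpa) ENNReal.ofReal_ne_top
    · intro t ht
      simp only [updateKernel_apply hη₀ hη₁, Measure.smul_apply, Measure.restrict_apply_univ,
        ← levelSetFun_eq hη₁, smul_eq_mul, Pi.one_apply]
      exact ENNReal.inv_mul_cancel (hlevel t ht).1 (hlevel t ht).2
  rw [sliceKernel, Kernel.piecewise_apply]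
  exact if_pos h

/-- Substituting `t = η₁ x * u` makes the domain of integration independent of the state. -/
lemma integral_stepKernel (hη₀ : Measurable η₀) (hη₁ : Measurable η₁)
    {x : EuclideanSpace ℝ (Fin d)} (hx : 0 < η₁ x)
    (hstep : stepKernel η₀ η₁ x Set.univ = 1)
    {f : EuclideanSpace ℝ (Fin d) → ℝ} (hf : IsBddMeasurable f) :
    ∫ y, f y ∂(stepKernel η₀ η₁ x)
      = ∫ u in Set.Ioo (0 : ℝ) 1, ∫ y, f y ∂(updateKernel η₀ η₁ (η₁ x * u)) := by
  have : IsFiniteMeasure (stepKernel η₀ η₁ x) := ⟨by simp [hstep]⟩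
  have hint := hf.integrable (stepKernel η₀ η₁ x)
  have hsm : StronglyMeasurable fun t => ∫ y, f y ∂(updateKernel η₀ η₁ t) := by
    have : IsFiniteKernel (updateKernel η₀ η₁) :=
      ⟨1, ENNReal.one_lt_top, updateKernel_apply_univ_le hη₀ hη₁⟩
    exact hf.measurable.stronglyMeasurable.integral_kernel
  rw [stepKernel] at hint ⊢
  rw [Kernel.integral_comp hint, thresholdKernel_apply hη₁, smul_restrict_Ioo_eq_map hx,
    integral_map (measurable_const_mul _).aemeasurable hsm.aestronglyMeasurable]

/-- Slice sampling is reversible with respect to its target distribution. -/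
theorem isReversible_sliceKernel (hη₀ : Measurable η₀) (hη₁ : Measurable η₁)
    {ν : Measure (EuclideanSpace ℝ (Fin d))} {Z : ℝ≥0∞}
    (hν : ν = Z • (refMeasure η₀).withDensity fun x => ENNReal.ofReal (η₁ x))
    (hgood : ∀ᵐ x ∂(refMeasure η₀), 0 < η₁ x → sliceKernel η₀ η₁ x = stepKernel η₀ η₁ x) :
    (sliceKernel η₀ η₁).IsReversible ν := by
  -- The right-hand side is symmetric in `A` and `B`, which is reversibility. It comes from Tonelli:
  -- conditionally on the threshold, the old and the new state are independent with the same law.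
  have key : ∀ A B, MeasurableSet A → MeasurableSet B →
      ∫⁻ x in A, sliceKernel η₀ η₁ x B ∂ν = Z * ∫⁻ t in Set.Ioi 0, (levelSetFun η₀ η₁ t)⁻¹ *
        refMeasure η₀ (B ∩ {x | t < η₁ x}) * refMeasure η₀ (A ∩ {x | t < η₁ x}) := by
    intro A B hA hB
    have hker : Measurable fun x => sliceKernel η₀ η₁ x B := Kernel.measurable_coe _ hB
    set w : ℝ → ℝ≥0∞ := fun t => (levelSetFun η₀ η₁ t)⁻¹ * refMeasure η₀ (B ∩ {x | t < η₁ x})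
      with hw
    have hwm : Measurable w := (measurable_levelSetFun hη₁).inv.mul
      (measurable_refMeasure_slice_inter hη₁ hB)
    -- The factor `η₁ x` in the density of `ν` cancels the normalisation of the uniform threshold.
    have hpoint : ∀ᵐ x ∂(refMeasure η₀).restrict A,
        ENNReal.ofReal (η₁ x) * sliceKernel η₀ η₁ x B
          = ∫⁻ t in Set.Ioi 0, {p : ℝ × EuclideanSpace ℝ (Fin d) | p.1 < η₁ p.2}.indicator
              (fun p => w p.1) (t, x) := by
      filter_upwards [ae_restrict_of_ae hgood] with x hx
      rcases le_or_gt (η₁ x) 0 with h0 | h0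
      · rw [ENNReal.ofReal_of_nonpos h0, zero_mul]
        refine ((setLIntegral_congr_fun (g := 0) measurableSet_Ioi fun t ht => ?_).trans
          (by simp)).symm
        exact Set.indicator_of_notMem (fun h => lt_asymm (h.trans_le h0) ht) _
      · rw [hx h0, stepKernel_apply hη₁ hB, ← mul_assoc,
          ENNReal.mul_inv_cancel (by simpa) ENNReal.ofReal_ne_top, one_mul,
          ← Set.Ioi_inter_Iio, Set.inter_comm, ← Measure.restrict_restrict measurableSet_Iio,
          ← lintegral_indicator measurableSet_Iio]
        refine lintegral_congr fun t => ?_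
        by_cases ht : t < η₁ x
        · rw [Set.indicator_of_mem (show t ∈ Set.Iio (η₁ x) from ht),
            Set.indicator_of_mem (show (t, x) ∈ {p : ℝ × _ | p.1 < η₁ p.2} from ht),
            updateKernel_apply hη₀ hη₁, Measure.smul_apply, Measure.restrict_apply hB, smul_eq_mul]
        · rw [Set.indicator_of_notMem (show t ∉ Set.Iio (η₁ x) from ht),
            Set.indicator_of_notMem (show (t, x) ∉ {p : ℝ × _ | p.1 < η₁ p.2} from ht)]
    rw [hν, Measure.restrict_smul, lintegral_smul_measure, smul_eq_mul,
      setLIntegral_withDensity_eq_setLIntegral_mul _ hη₁.ennreal_ofReal hker hA]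
    congr 1
    simp only [Pi.mul_apply]
    have hjoint : Measurable (Function.uncurry fun (x : EuclideanSpace ℝ (Fin d)) (t : ℝ) =>
        {p : ℝ × EuclideanSpace ℝ (Fin d) | p.1 < η₁ p.2}.indicator (fun p => w p.1) (t, x)) :=
      ((hwm.comp measurable_fst).indicator (measurableSet_slices hη₁)).comp measurable_swap
    rw [lintegral_congr_ae hpoint, lintegral_lintegral_swap hjoint.aemeasurable]
    refine lintegral_congr fun t => ?_
    have : ∀ x, {p : ℝ × EuclideanSpace ℝ (Fin d) | p.1 < η₁ p.2}.indicator
        (fun p => w p.1) (t, x) = {x | t < η₁ x}.indicator (fun _ => w t) x := fun x => rfl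
    simp_rw [this]
    rw [lintegral_indicator_const (measurableSet_slice hη₁ t),
      Measure.restrict_apply (measurableSet_slice hη₁ t), Set.inter_comm]
  intro A B hA hB
  rw [key A B hA hB, key B A hB hA]
  congr 1
  exact lintegral_congr fun t => by ring

end Slices

/-! ### Exponential potentials with power-law sublevel masses -/

section ExponentialSlices

variable {d : ℕ}

/-- The factor `η₁` is `c * exp (-V)`, and the sublevel sets `{V < w}` of the potential `V` have
mass `C * w ^ α` with respect to the measure with density `η₀`. -/
structure HasExpPotential (η₀ η₁ V : EuclideanSpace ℝ (Fin d) → ℝ) (c α : ℝ) (C : ℝ≥0∞) :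
    Prop where
  measurable₀ : Measurable η₀
  measurable₁ : Measurable η₁
  measurable_potential : Measurable V
  c_pos : 0 < c
  α_pos : 0 < α
  ne_zero : C ≠ 0
  ne_top : C ≠ ∞
  sublevel : ∀ w, 0 < w → refMeasure η₀ {x | V x < w} = C * ENNReal.ofReal (w ^ α)
  ae_eq : ∀ᵐ x ∂(refMeasure η₀), η₁ x = c * Real.exp (-V x)

lemma log_div_pos {c t : ℝ} (ht : t ∈ Set.Ioo 0 c) : 0 < Real.log (c / t) :=
  Real.log_pos ((one_lt_div ht.1).2 ht.2)

namespace HasExpPotential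

variable {η₀ η₁ V : EuclideanSpace ℝ (Fin d) → ℝ} {c α : ℝ} {C : ℝ≥0∞}

/-- The set `{V ≤ 0}` lies in every `{V < w}` with `w > 0`, and these masses tend to `0` since `α >
0`. -/
lemma ae_potential_pos (h : HasExpPotential η₀ η₁ V c α C) :
    ∀ᵐ x ∂(refMeasure η₀), 0 < V x := by
  have hlim : Filter.Tendsto (fun w : ℝ => C * ENNReal.ofReal (w ^ α)) (nhdsWithin 0 (Set.Ioi 0))
      (nhds 0) := by
    have h1 : Filter.Tendsto (fun w : ℝ => w ^ α) (nhdsWithin 0 (Set.Ioi 0)) (nhds 0) := by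
      have := (Real.continuousAt_rpow_const 0 α (.inr h.α_pos.le)).tendsto
      rw [Real.zero_rpow h.α_pos.ne'] at this
      exact this.mono_left nhdsWithin_le_nhds
    have h2 := ENNReal.Tendsto.const_mul (a := C)
      ((ENNReal.continuous_ofReal.tendsto 0).comp h1) (.inr h.ne_top)
    simpa using h2
  have hle : refMeasure η₀ {x | V x ≤ 0} ≤ 0 := by
    refine ge_of_tendsto hlim ?_
    filter_upwards [self_mem_nhdsWithin] with w hw
    rw [← h.sublevel w hw]
    exact measure_mono fun x (hx : V x ≤ 0) => show V x < w from hx.trans_lt hw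
  rw [ae_iff]
  simpa using hle

lemma slice_ae_eq (h : HasExpPotential η₀ η₁ V c α C) {t : ℝ} (ht : 0 < t) :
    {x | t < η₁ x} =ᵐ[refMeasure η₀] {x | V x < Real.log (c / t)} := by
  filter_upwards [h.ae_eq] with x hx
  refine propext ?_
  change t < η₁ x ↔ V x < Real.log (c / t)
  rw [hx, Real.lt_log_iff_exp_lt (div_pos h.c_pos ht), lt_div_iff₀ ht, Real.exp_neg,
    ← div_eq_mul_inv, lt_div_iff₀ (Real.exp_pos _), mul_comm]

lemma levelSetFun_eq (h : HasExpPotential η₀ η₁ V c α C) {t : ℝ} (ht : t ∈ Set.Ioo 0 c) :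
    levelSetFun η₀ η₁ t = C * ENNReal.ofReal (Real.log (c / t) ^ α) := by
  rw [SliceSampling.levelSetFun_eq h.measurable₁, measure_congr (h.slice_ae_eq ht.1),
    h.sublevel _ (log_div_pos ht)]

/-- Where `V x > 0`, every threshold below `η₁ x` is below `c`, and there the level masses are
positive and finite. -/
lemma sliceKernel_ae_eq (h : HasExpPotential η₀ η₁ V c α C) :
    ∀ᵐ x ∂(refMeasure η₀), η₁ x = c * Real.exp (-V x) ∧ 0 < V x ∧
      sliceKernel η₀ η₁ x = stepKernel η₀ η₁ x := by
  filter_upwards [h.ae_eq, h.ae_potential_pos] with x hx hV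
  refine ⟨hx, hV, sliceKernel_apply h.measurable₀ h.measurable₁ ?_ fun t ht => ?_⟩
  · rw [hx]; exact mul_pos h.c_pos (Real.exp_pos _)
  have htc : t ∈ Set.Ioo 0 c := by
    refine ⟨ht.1, ht.2.trans ?_⟩
    rw [hx]
    exact mul_lt_of_lt_one_right h.c_pos (Real.exp_lt_one_iff.2 (by linarith))
  rw [h.levelSetFun_eq htc]
  have := Real.rpow_pos_of_pos (log_div_pos htc) α
  exact ⟨mul_ne_zero h.ne_zero (by simpa using this),
    ENNReal.mul_ne_top h.ne_top ENNReal.ofReal_ne_top⟩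

/-- Under the update at level `t`, the potential is distributed as `log (c / t) * U ^ (1 / α)` with
`U` uniform on `(0, 1)`. -/
lemma map_updateKernel (h : HasExpPotential η₀ η₁ V c α C) {t : ℝ} (ht : t ∈ Set.Ioo 0 c) :
    (updateKernel η₀ η₁ t).map V
      = (volume.restrict (Set.Ioo (0 : ℝ) 1)).map fun u => Real.log (c / t) * u ^ (1 / α) := by
  have hw := log_div_pos ht
  have hCw : C * ENNReal.ofReal (Real.log (c / t) ^ α) ≠ 0 :=
    mul_ne_zero h.ne_zero (by simpa using Real.rpow_pos_of_pos hw α)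
  have hCw' : C * ENNReal.ofReal (Real.log (c / t) ^ α) ≠ ∞ :=
    ENNReal.mul_ne_top h.ne_top ENNReal.ofReal_ne_top
  -- Both laws are compared through their distribution functions, which equal `(s / w) ^ α` for `0 <
  -- s < w = log (c / t)`.
  have hcdf (s : ℝ) : (updateKernel η₀ η₁ t).map V (Set.Iio s)
      = (C * ENNReal.ofReal (Real.log (c / t) ^ α))⁻¹
        * refMeasure η₀ {x | V x < min s (Real.log (c / t))} := by
    rw [Measure.map_apply h.measurable_potential measurableSet_Iio,
      updateKernel_apply h.measurable₀ h.measurable₁, h.levelSetFun_eq ht,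
      Measure.restrict_congr_set (h.slice_ae_eq ht.1), Measure.smul_apply, smul_eq_mul,
      Measure.restrict_apply (h.measurable_potential measurableSet_Iio)]
    congr 2
    ext x
    simp
  generalize Real.log (c / t) = w at hw hcdf hCw hCw' ⊢
  have hmeas : Measurable fun u : ℝ => w * u ^ (1 / α) := by fun_prop
  have hcdf' (s : ℝ) : (volume.restrict (Set.Ioo (0 : ℝ) 1)).map (fun u => w * u ^ (1 / α))
      (Set.Iio s) = volume {u : ℝ | w * u ^ (1 / α) < s ∧ u ∈ Set.Ioo (0 : ℝ) 1} := by
    rw [Measure.map_apply hmeas measurableSet_Iio,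
      Measure.restrict_apply (hmeas measurableSet_Iio)]
    rfl
  have huniv : (updateKernel η₀ η₁ t).map V Set.univ = 1 := by
    rw [Measure.map_apply h.measurable_potential MeasurableSet.univ,
      updateKernel_apply h.measurable₀ h.measurable₁]
    simp only [Set.preimage_univ, Measure.smul_apply, Measure.restrict_apply_univ, smul_eq_mul]
    rw [← SliceSampling.levelSetFun_eq h.measurable₁]
    have h1 := log_div_pos ht
    rw [h.levelSetFun_eq ht]
    exact ENNReal.inv_mul_cancel
      (mul_ne_zero h.ne_zero (by simpa using Real.rpow_pos_of_pos h1 α))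
      (ENNReal.mul_ne_top h.ne_top ENNReal.ofReal_ne_top)
  have : IsFiniteMeasure ((updateKernel η₀ η₁ t).map V) := ⟨by simp [huniv]⟩
  refine ext_of_generate_finite _ (borel_eq_generateFrom_Iio ℝ ▸ BorelSpace.measurable_eq)
    isPiSystem_Iio ?_ ?_
  · rintro _ ⟨s, rfl⟩
    rw [hcdf, hcdf']
    rcases le_or_gt s 0 with hs | hs
    · have h1 : refMeasure η₀ {x | V x < min s w} = 0 := by
        refine measure_mono_null ?_ (ae_iff.1 h.ae_potential_pos)
        exact fun x hx => not_lt.2 ((lt_of_lt_of_le hx (min_le_left _ _)).le.trans hs)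
      have h2 : {u : ℝ | w * u ^ (1 / α) < s ∧ u ∈ Set.Ioo (0 : ℝ) 1} = ∅ := by
        refine Set.eq_empty_of_forall_notMem fun u hu => ?_
        have := mul_pos hw (Real.rpow_pos_of_pos hu.2.1 (1 / α))
        linarith [hu.1]
      rw [h1, h2, mul_zero, measure_empty]
    rcases le_or_gt w s with hsw | hsw
    · have h2 : {u : ℝ | w * u ^ (1 / α) < s ∧ u ∈ Set.Ioo (0 : ℝ) 1} = Set.Ioo 0 1 := by
        refine Set.Subset.antisymm (fun u hu => hu.2) fun u hu => ⟨?_, hu⟩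
        have := Real.rpow_lt_one hu.1.le hu.2 (one_div_pos.2 h.α_pos)
        exact (mul_lt_of_lt_one_right hw this).trans_le hsw
      rw [min_eq_right hsw, h.sublevel w hw, h2, ENNReal.inv_mul_cancel hCw hCw']
      simp
    · have hdiv : 0 < s / w := div_pos hs hw
      have h2 : {u : ℝ | w * u ^ (1 / α) < s ∧ u ∈ Set.Ioo (0 : ℝ) 1}
          = Set.Ioo 0 ((s / w) ^ α) := by
        have hle : (s / w) ^ α < 1 :=
          Real.rpow_lt_one hdiv.le ((div_lt_one hw).2 hsw) h.α_pos
        have hiff : ∀ u : ℝ, 0 < u → (w * u ^ (1 / α) < s ↔ u < (s / w) ^ α) := fun u hu => by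
          rw [mul_comm, ← lt_div_iff₀ hw, one_div, Real.rpow_inv_lt_iff_of_pos hu.le hdiv.le
            h.α_pos]
        ext u
        exact ⟨fun hu => ⟨hu.2.1, (hiff u hu.2.1).1 hu.1⟩,
          fun hu => ⟨(hiff u hu.1).2 hu.2, hu.1, hu.2.trans hle⟩⟩
      rw [min_eq_left hsw.le, h.sublevel s hs, h2, Real.volume_Ioo, sub_zero,
        Real.div_rpow hs.le hw.le, ENNReal.ofReal_div_of_pos (Real.rpow_pos_of_pos hw α),
        ENNReal.mul_inv (.inl h.ne_zero) (.inl h.ne_top), div_eq_mul_inv]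
      calc C⁻¹ * (ENNReal.ofReal (w ^ α))⁻¹ * (C * ENNReal.ofReal (s ^ α))
          = (C⁻¹ * C) * (ENNReal.ofReal (s ^ α) * (ENNReal.ofReal (w ^ α))⁻¹) := by ring
        _ = _ := by rw [ENNReal.inv_mul_cancel h.ne_zero h.ne_top, one_mul]
  · rw [huniv, Measure.map_apply hmeas MeasurableSet.univ]
    simp

/-- The potential is square integrable under the target distribution. -/
lemma lintegral_sq_potential_lt_top (h : HasExpPotential η₀ η₁ V c α C) :
    ∫⁻ x, ENNReal.ofReal (η₁ x) * ENNReal.ofReal (V x ^ 2) ∂(refMeasure η₀) < ∞ := by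
  -- Writing `exp (-V) = ∫ w in Ioi V, exp (-w)` and bounding `V²` by `w²` there, Tonelli reduces
  -- the claim to the Gamma integral of `w ^ (α + 2) * exp (-w)`.
  set F : ℝ → ℝ≥0∞ := fun w => ENNReal.ofReal (c * (w ^ 2 * Real.exp (-w))) with hF
  have hFm : Measurable F := by fun_prop
  have hpoint : ∀ᵐ x ∂(refMeasure η₀), ENNReal.ofReal (η₁ x) * ENNReal.ofReal (V x ^ 2)
      ≤ ∫⁻ w in Set.Ioi 0, {p : ℝ × EuclideanSpace ℝ (Fin d) | V p.2 < p.1}.indicator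
          (fun p => F p.1) (w, x) := by
    filter_upwards [h.ae_eq, h.ae_potential_pos] with x hx hV
    have hexp := integrableOn_exp_neg_Ioi (V x)
    calc ENNReal.ofReal (η₁ x) * ENNReal.ofReal (V x ^ 2)
        = ENNReal.ofReal (c * V x ^ 2) * ∫⁻ w in Set.Ioi (V x), ENNReal.ofReal (Real.exp (-w)) := by
          rw [← ofReal_integral_eq_lintegral_ofReal hexp (.of_forall fun w => (Real.exp_pos _).le),
            integral_exp_neg_Ioi, ← ENNReal.ofReal_mul' (sq_nonneg _),
            ← ENNReal.ofReal_mul' (Real.exp_pos _).le, hx]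
          ring_nf
      _ = ∫⁻ w in Set.Ioi (V x), ENNReal.ofReal (c * V x ^ 2) * ENNReal.ofReal (Real.exp (-w)) := by
          rw [lintegral_const_mul _ (by fun_prop)]
      _ ≤ ∫⁻ w in Set.Ioi (V x), F w := by
          refine setLIntegral_mono hFm fun w hw => ?_
          rw [← ENNReal.ofReal_mul' (Real.exp_pos _).le, mul_assoc]
          change _ ≤ ENNReal.ofReal (c * (w ^ 2 * Real.exp (-w)))
          have hw' : V x < w := hw
          have := h.c_pos.le
          gcongr
      _ = ∫⁻ w in Set.Ioi 0, (Set.Ioi (V x)).indicator F w := by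
          rw [lintegral_indicator measurableSet_Ioi, Measure.restrict_restrict measurableSet_Ioi,
            Set.Ioi_inter_Ioi, max_eq_left hV.le]
      _ = _ := rfl
  have hslices : MeasurableSet {p : ℝ × EuclideanSpace ℝ (Fin d) | V p.2 < p.1} :=
    measurableSet_lt (h.measurable_potential.comp measurable_snd) measurable_fst
  have hjoint : Measurable (Function.uncurry fun (x : EuclideanSpace ℝ (Fin d)) (w : ℝ) =>
      {p : ℝ × EuclideanSpace ℝ (Fin d) | V p.2 < p.1}.indicator (fun p => F p.1) (w, x)) :=
    ((hFm.comp measurable_fst).indicator hslices).comp measurable_swap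
  refine (lintegral_mono_ae hpoint).trans_lt ?_
  rw [lintegral_lintegral_swap hjoint.aemeasurable]
  calc ∫⁻ w in Set.Ioi 0, ∫⁻ x, {p : ℝ × EuclideanSpace ℝ (Fin d) | V p.2 < p.1}.indicator
          (fun p => F p.1) (w, x) ∂(refMeasure η₀)
      = ∫⁻ w in Set.Ioi 0,
          C * ENNReal.ofReal (c * (Real.exp (-w) * w ^ (α + 3 - 1))) := by
        refine setLIntegral_congr_fun measurableSet_Ioi fun w hw => ?_
        have hw' : 0 < w := hw
        have : ∀ x, {p : ℝ × EuclideanSpace ℝ (Fin d) | V p.2 < p.1}.indicator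
            (fun p => F p.1) (w, x) = {x | V x < w}.indicator (fun _ => F w) x := fun x => rfl
        simp_rw [this]
        rw [lintegral_indicator_const (measurableSet_lt h.measurable_potential measurable_const),
          h.sublevel w hw,
          mul_left_comm, hF, ← ENNReal.ofReal_mul' (by positivity)]
        congr 2
        rw [show α + 3 - 1 = 2 + α by ring, Real.rpow_add hw', Real.rpow_two]
        ring
    _ = C * ∫⁻ w in Set.Ioi 0, ENNReal.ofReal (c * (Real.exp (-w) * w ^ (α + 3 - 1))) := by
        rw [lintegral_const_mul _ (by fun_prop)]
    _ < ∞ := by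
        refine ENNReal.mul_lt_top h.ne_top.lt_top ?_
        have := (Real.GammaIntegral_convergent (s := α + 3) (by linarith [h.α_pos])).const_mul c
        exact (hasFiniteIntegral_iff_ofReal ((ae_restrict_iff' measurableSet_Ioi).2
          (.of_forall fun w hw => by
            have hw' : (0 : ℝ) < w := hw
            have := h.c_pos.le
            positivity))).1 this.2

end HasExpPotential

end ExponentialSlices

/-! ### Lipschitz functions of the potential and their contraction -/

section Profiles

lemma continuous_of_abs_sub_le {φ : ℝ → ℝ} {L : ℝ}
    (hφ : ∀ v v', |φ v - φ v'| ≤ L * |v - v'|) : Continuous φ :=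
  (LipschitzWith.of_dist_le' fun v v' => hφ v v').continuous

/-- Averaging a bounded function over `(0, c * exp (-v))` is Lipschitz in `v`. -/
lemma abs_average_sub_le {H : ℝ → ℝ} {M c : ℝ} (hc : 0 < c) (hH : Measurable H) (hM0 : 0 ≤ M)
    (hM : ∀ t, |H t| ≤ M) (v v' : ℝ) :
    |(∫ u in Set.Ioo (0 : ℝ) 1, H (c * Real.exp (-v) * u))
      - ∫ u in Set.Ioo (0 : ℝ) 1, H (c * Real.exp (-v') * u)| ≤ 2 * M * |v - v'| := by
  wlog hvv : v ≤ v' generalizing v v'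
  · rw [abs_sub_comm, abs_sub_comm v]
    exact this v' v (le_of_not_ge hvv)
  have hint (a b : ℝ) : IntervalIntegrable H volume a b := by
    rw [intervalIntegrable_iff]
    exact Measure.integrableOn_of_bounded (by simp) hH.aestronglyMeasurable (.of_forall hM)
  have hav (τ : ℝ) : τ * (∫ u in Set.Ioo (0 : ℝ) 1, H (τ * u)) = ∫ t in (0 : ℝ)..τ, H t := by
    rw [← integral_Ioc_eq_integral_Ioo, ← intervalIntegral.integral_of_le zero_le_one,
      intervalIntegral.mul_integral_comp_mul_left, mul_zero, mul_one]
  have hbd (τ : ℝ) : |∫ u in Set.Ioo (0 : ℝ) 1, H (τ * u)| ≤ M :=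
    IsBddMeasurable.abs_integral_le hM0 (fun u => hM _) _ (by simp)
  set τ := c * Real.exp (-v) with hτ
  set τ' := c * Real.exp (-v') with hτ'
  have hτ0 : 0 < τ := mul_pos hc (Real.exp_pos _)
  have hττ : τ' ≤ τ := by rw [hτ, hτ']; gcongr
  set A := ∫ u in Set.Ioo (0 : ℝ) 1, H (τ * u)
  set B := ∫ u in Set.Ioo (0 : ℝ) 1, H (τ' * u)
  -- Both terms on the right are at most `M * (τ - τ')`, the source of the constant `2 * M`.
  have hsplit : τ * (A - B) = (∫ t in τ'..τ, H t) + (τ' - τ) * B := by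
    have h1 := intervalIntegral.integral_add_adjacent_intervals (hint 0 τ') (hint τ' τ)
    rw [← hav, ← hav] at h1
    linear_combination -h1
  have hmid : |∫ t in τ'..τ, H t| ≤ M * (τ - τ') := by
    have := intervalIntegral.norm_integral_le_of_norm_le_const (a := τ') (b := τ) (f := H) (C := M)
      fun t _ => hM t
    rwa [abs_of_nonneg (sub_nonneg.2 hττ)] at this
  have hkey : τ * |A - B| ≤ 2 * M * (τ - τ') := by
    rw [← abs_of_pos hτ0, ← abs_mul, abs_of_pos hτ0, hsplit]
    calc _ ≤ |∫ t in τ'..τ, H t| + |(τ' - τ) * B| := abs_add_le _ _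
      _ ≤ M * (τ - τ') + (τ - τ') * M := by
        rw [abs_mul, abs_sub_comm, abs_of_nonneg (sub_nonneg.2 hττ)]
        gcongr
        exact hbd _
      _ = _ := by ring
  -- This is `1 - exp (-x) ≤ x` with `x = v' - v`, scaled by `τ`.
  have hdiff : τ - τ' ≤ τ * |v - v'| := by
    have hexp : τ' = τ * Real.exp (v - v') := by
      rw [hτ, hτ', mul_assoc, ← Real.exp_add]; ring_nf
    have := Real.add_one_le_exp (v - v')
    rw [abs_of_nonpos (sub_nonpos.2 hvv), hexp]
    nlinarith
  refine le_of_mul_le_mul_left ?_ hτ0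
  calc τ * |A - B| ≤ 2 * M * (τ - τ') := hkey
    _ ≤ 2 * M * (τ * |v - v'|) := by gcongr
    _ = τ * (2 * M * |v - v'|) := by ring

lemma integral_Ioo_rpow_one_div {α : ℝ} (hα : 0 < α) :
    ∫ s in Set.Ioo (0 : ℝ) 1, s ^ (1 / α) = α / (α + 1) := by
  have : 0 < 1 / α := by positivity
  rw [← integral_Ioc_eq_integral_Ioo, ← intervalIntegral.integral_of_le zero_le_one,
    integral_rpow (.inl (by linarith))]
  rw [Real.one_rpow, Real.zero_rpow (by linarith)]
  field_simp
  ring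

/-- Rescaling by independent variables `U ^ (1 / α)` after a random translation contracts the
Lipschitz constant. -/
lemma abs_rescale_sub_le {φ : ℝ → ℝ} {M L α : ℝ} (hα : 0 < α) (hM0 : 0 ≤ M)
    (hM : ∀ t, |φ t| ≤ M) (hφ : ∀ v v', |φ v - φ v'| ≤ L * |v - v'|) (v v' : ℝ) :
    |(∫ u in Set.Ioo (0 : ℝ) 1, ∫ s in Set.Ioo (0 : ℝ) 1, φ ((v - Real.log u) * s ^ (1 / α)))
      - ∫ u in Set.Ioo (0 : ℝ) 1, ∫ s in Set.Ioo (0 : ℝ) 1, φ ((v' - Real.log u) * s ^ (1 / α))|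
      ≤ α / (α + 1) * L * |v - v'| := by
  have hcont := continuous_of_abs_sub_le hφ
  have hrpow : IntegrableOn (fun s : ℝ => s ^ (1 / α)) (Set.Ioo 0 1) := by
    refine ((intervalIntegrable_iff_integrableOn_Ioo_of_le zero_le_one).1
      (intervalIntegral.intervalIntegrable_rpow' ?_))
    have : 0 < 1 / α := by positivity
    linarith
  have hinner (w : ℝ) : Integrable (fun s : ℝ => φ (w * s ^ (1 / α)))
      (volume.restrict (Set.Ioo 0 1)) :=
    Measure.integrableOn_of_bounded (by simp) (hcont.measurable.comp (by fun_prop)).aestronglyMeasurable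
      (.of_forall fun s => hM _)
  set G : ℝ → ℝ := fun w => ∫ s in Set.Ioo (0 : ℝ) 1, φ (w * s ^ (1 / α)) with hG
  -- With the same `s` on both sides the distance shrinks by `s ^ (1 / α)`, whose mean is `α / (α +
  -- 1)`; the later average over the common shift `-log u` costs nothing.
  have hGL (w w' : ℝ) : |G w - G w'| ≤ α / (α + 1) * L * |w - w'| := by
    rw [hG]
    simp only
    rw [← integral_sub (hinner w) (hinner w')]
    refine (abs_integral_le_integral_abs).trans ?_
    rw [mul_assoc, ← integral_Ioo_rpow_one_div hα, ← integral_mul_const]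
    refine setIntegral_mono_on ((hinner w).sub (hinner w')).abs (hrpow.mul_const _)
      measurableSet_Ioo fun s hs => (hφ _ _).trans_eq ?_
    rw [← sub_mul, abs_mul, abs_of_nonneg (Real.rpow_nonneg hs.1.le _)]
    ring
  have hGM (w : ℝ) : |G w| ≤ M := IsBddMeasurable.abs_integral_le hM0 (fun u => hM _) _ (by simp)
  have hGcont := continuous_of_abs_sub_le hGL
  have houter (v : ℝ) : Integrable (fun u : ℝ => G (v - Real.log u))
      (volume.restrict (Set.Ioo 0 1)) :=
    Measure.integrableOn_of_bounded (by simp)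
      (hGcont.measurable.comp (by fun_prop)).aestronglyMeasurable (.of_forall fun u => hGM _)
  change |(∫ u in Set.Ioo (0 : ℝ) 1, G (v - Real.log u))
    - ∫ u in Set.Ioo (0 : ℝ) 1, G (v' - Real.log u)| ≤ _
  rw [← integral_sub (houter v) (houter v')]
  have := norm_setIntegral_le_of_norm_le_const (s := Set.Ioo (0 : ℝ) 1) (μ := volume)
    (f := fun u => G (v - Real.log u) - G (v' - Real.log u)) (C := α / (α + 1) * L * |v - v'|)
    (by simp) fun u _ => (hGL _ _).trans_eq (by congr 2; ring)
  simpa using this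

/-- `f` agrees almost everywhere with a function of `V` that is bounded by `M` and Lipschitz with
constant `L`. -/
def HasLipschitzProfile {G : Type*} [MeasurableSpace G] (ν : Measure G) (V : G → ℝ) (M L : ℝ)
    (f : G → ℝ) : Prop :=
  ∃ φ : ℝ → ℝ, (∀ v v', |φ v - φ v'| ≤ L * |v - v'|) ∧ (∀ v, |φ v| ≤ M) ∧ f =ᵐ[ν] fun x => φ (V x)

/-- Since `f` is centred, `∫ f² ≤ ∫ f² + φ(0)² = ∫ (f - φ(0))²`, and `|f - φ(0)| ≤ L * |V|` almost
everywhere. -/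
lemma HasLipschitzProfile.integral_sq_le {G : Type*} [MeasurableSpace G] {ν : Measure G}
    [IsProbabilityMeasure ν] {V : G → ℝ} {M L : ℝ} {f : G → ℝ} (h : HasLipschitzProfile ν V M L f)
    (hf : IsBddMeasurable f) (hcent : ∫ x, f x ∂ν = 0) (hV : Integrable (fun x => V x ^ 2) ν) :
    ∫ x, f x ^ 2 ∂ν ≤ L ^ 2 * ∫ x, V x ^ 2 ∂ν := by
  obtain ⟨φ, hL, -, hfφ⟩ := h
  have hsq : Integrable (fun x => f x ^ 2) ν := by
    simpa only [pow_two] using (hf.mul hf).integrable ν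
  have hlin : Integrable (fun x => 2 * φ 0 * f x) ν := (hf.integrable ν).const_mul _
  have hdiff : Integrable (fun x => f x ^ 2 - 2 * φ 0 * f x) ν := hsq.sub hlin
  have hexpand : ∫ x, (f x ^ 2 - 2 * φ 0 * f x + φ 0 ^ 2) ∂ν = ∫ x, f x ^ 2 ∂ν + φ 0 ^ 2 := by
    rw [integral_add hdiff (integrable_const _), integral_sub hsq hlin, integral_const_mul, hcent]
    simp
  have hle : ∫ x, (f x ^ 2 - 2 * φ 0 * f x + φ 0 ^ 2) ∂ν ≤ ∫ x, L ^ 2 * V x ^ 2 ∂ν := by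
    refine integral_mono_ae (hdiff.add (integrable_const _)) (hV.const_mul _) ?_
    filter_upwards [hfφ] with x hx
    have h1 := hL (V x) 0
    rw [← hx, sub_zero] at h1
    have h2 := pow_le_pow_left₀ (abs_nonneg _) h1 2
    rw [sq_abs, mul_pow, sq_abs] at h2
    linarith
  rw [hexpand, integral_const_mul] at hle
  nlinarith [sq_nonneg (φ 0)]

end Profiles

/-! ### Spectral gap for exponential potentials -/

section Gap

variable {d : ℕ} {η₀ η₁ V : EuclideanSpace ℝ (Fin d) → ℝ} {c α : ℝ} {C Z : ℝ≥0∞}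
  {ν : Measure (EuclideanSpace ℝ (Fin d))}

namespace HasExpPotential

lemma ae_of_ae_refMeasure (hν : ν = Z • (refMeasure η₀).withDensity fun x => ENNReal.ofReal (η₁ x))
    {p : EuclideanSpace ℝ (Fin d) → Prop} (hp : ∀ᵐ x ∂(refMeasure η₀), p x) : ∀ᵐ x ∂ν, p x := by
  have hac : ν ≪ refMeasure η₀ := by
    rw [hν]
    exact Measure.smul_absolutelyContinuous.trans (withDensity_absolutelyContinuous _ _)
  exact hac.ae_le hp

lemma isReversible (h : HasExpPotential η₀ η₁ V c α C)
    (hν : ν = Z • (refMeasure η₀).withDensity fun x => ENNReal.ofReal (η₁ x)) :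
    (sliceKernel η₀ η₁).IsReversible ν :=
  isReversible_sliceKernel h.measurable₀ h.measurable₁ hν
    (h.sliceKernel_ae_eq.mono fun _ hx _ => hx.2.2)

/-- The state enters only through `V x`, so one step makes any bounded function a function of the
potential. -/
lemma markovOp_eq (h : HasExpPotential η₀ η₁ V c α C) :
    ∀ᵐ x ∂(refMeasure η₀), 0 < V x ∧ ∀ f, IsBddMeasurable f →
      markovOp (sliceKernel η₀ η₁) f x = ∫ u in Set.Ioo (0 : ℝ) 1,
        ∫ y, f y ∂(updateKernel η₀ η₁ (c * Real.exp (-V x) * u)) := by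
  filter_upwards [h.sliceKernel_ae_eq] with x ⟨hx, hV, hker⟩
  refine ⟨hV, fun f hf => ?_⟩
  have hpos : 0 < η₁ x := hx ▸ mul_pos h.c_pos (Real.exp_pos _)
  rw [markovOp, hker, integral_stepKernel h.measurable₀ h.measurable₁ hpos ?_ hf, hx]
  rw [← hker, measure_univ]

lemma hasLipschitzProfile_markovOp (h : HasExpPotential η₀ η₁ V c α C)
    (hν : ν = Z • (refMeasure η₀).withDensity fun x => ENNReal.ofReal (η₁ x))
    {f : EuclideanSpace ℝ (Fin d) → ℝ} (hf : IsBddMeasurable f) {M : ℝ} (hM0 : 0 ≤ M)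
    (hM : ∀ x, |f x| ≤ M) :
    HasLipschitzProfile ν V M (2 * M) (markovOp (sliceKernel η₀ η₁) f) := by
  have hle := updateKernel_apply_univ_le h.measurable₀ h.measurable₁
  have hHM (t : ℝ) : |∫ y, f y ∂(updateKernel η₀ η₁ t)| ≤ M :=
    IsBddMeasurable.abs_integral_le hM0 hM _ (hle t)
  have : IsFiniteKernel (updateKernel η₀ η₁) := ⟨1, ENNReal.one_lt_top, hle⟩
  refine ⟨fun v => ∫ u in Set.Ioo (0 : ℝ) 1,
    ∫ y, f y ∂(updateKernel η₀ η₁ (c * Real.exp (-v) * u)),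
    abs_average_sub_le h.c_pos hf.measurable.stronglyMeasurable.integral_kernel.measurable hM0 hHM,
    fun v => IsBddMeasurable.abs_integral_le hM0 (fun u => hHM _) _ (by simp), ?_⟩
  filter_upwards [ae_of_ae_refMeasure hν h.markovOp_eq] with x hx using hx.2 f hf

lemma hasLipschitzProfile_markovOp_of_profile (h : HasExpPotential η₀ η₁ V c α C)
    (hν : ν = Z • (refMeasure η₀).withDensity fun x => ENNReal.ofReal (η₁ x))
    [IsFiniteMeasure ν] {f : EuclideanSpace ℝ (Fin d) → ℝ} {M L : ℝ} (hM0 : 0 ≤ M)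
    (hf : HasLipschitzProfile ν V M L f) :
    HasLipschitzProfile ν V M (α / (α + 1) * L) (markovOp (sliceKernel η₀ η₁) f) := by
  obtain ⟨φ, hL, hM, hfφ⟩ := hf
  have hcont := continuous_of_abs_sub_le hL
  have hφV : IsBddMeasurable fun x => φ (V x) :=
    ⟨hcont.measurable.comp h.measurable_potential, M, hM0, fun x => hM _⟩
  refine ⟨fun v => ∫ u in Set.Ioo (0 : ℝ) 1, ∫ s in Set.Ioo (0 : ℝ) 1,
    φ ((v - Real.log u) * s ^ (1 / α)), abs_rescale_sub_le h.α_pos hM0 hM hL, fun v =>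
    IsBddMeasurable.abs_integral_le hM0 (fun u =>
      IsBddMeasurable.abs_integral_le hM0 (fun s => hM _) _ (by simp)) _ (by simp), ?_⟩
  filter_upwards [markovOp_ae_congr (h.isReversible hν).invariant hfφ,
    ae_of_ae_refMeasure hν h.markovOp_eq] with x hx hx'
  rw [hx, hx'.2 _ hφV]
  refine setIntegral_congr_fun measurableSet_Ioo fun u hu => ?_
  have hexp := Real.exp_pos (-V x)
  have ht : c * Real.exp (-V x) * u ∈ Set.Ioo 0 c := by
    refine ⟨mul_pos (mul_pos h.c_pos hexp) hu.1, ?_⟩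
    have h1 : Real.exp (-V x) < 1 := Real.exp_lt_one_iff.2 (by linarith [hx'.1])
    rw [mul_assoc]
    exact mul_lt_of_lt_one_right h.c_pos (mul_lt_one_of_nonneg_of_lt_one_left hexp.le h1 hu.2.le)
  -- The exponential increment: `-log u` is standard exponential for uniform `u`.
  have hlog : Real.log (c / (c * Real.exp (-V x) * u)) = V x - Real.log u := by
    have hc := h.c_pos.ne'
    rw [mul_assoc, Real.log_div hc (mul_pos h.c_pos (mul_pos hexp hu.1)).ne',
      Real.log_mul hc (mul_pos hexp hu.1).ne', Real.log_mul hexp.ne' hu.1.ne', Real.log_exp]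
    ring
  have h1 := integral_map (μ := updateKernel η₀ η₁ (c * Real.exp (-V x) * u))
    h.measurable_potential.aemeasurable (f := φ) hcont.aestronglyMeasurable
  rw [← h1, h.map_updateKernel ht, hlog, integral_map (by fun_prop) hcont.aestronglyMeasurable]

lemma integrable_sq_potential (h : HasExpPotential η₀ η₁ V c α C)
    (hν : ν = Z • (refMeasure η₀).withDensity fun x => ENNReal.ofReal (η₁ x)) (hZ : Z ≠ ∞) :
    Integrable (fun x => V x ^ 2) ν := by
  have hVm := h.measurable_potential
  have hm : Measurable fun x => V x ^ 2 := by fun_prop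
  refine ⟨hm.aestronglyMeasurable, ?_⟩
  rw [hasFiniteIntegral_iff_ofReal (.of_forall fun x => sq_nonneg _), hν, lintegral_smul_measure,
    lintegral_withDensity_eq_lintegral_mul _ h.measurable₁.ennreal_ofReal hm.ennreal_ofReal]
  exact ENNReal.mul_lt_top hZ.lt_top h.lintegral_sq_potential_lt_top

/-- For an exponential potential with sublevel masses proportional to `w ^ α`, slice sampling
contracts the deviation from equilibrium by `α / (α + 1)`. -/
theorem deviationNorm_le [IsProbabilityMeasure ν] (h : HasExpPotential η₀ η₁ V c α C)
    (hν : ν = Z • (refMeasure η₀).withDensity fun x => ENNReal.ofReal (η₁ x)) (hZ : Z ≠ ∞) :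
    deviationNorm ν (sliceKernel η₀ η₁) ≤ ENNReal.ofReal (α / (α + 1)) := by
  have hα := h.α_pos
  have hrev := h.isReversible hν
  have hr : 0 < α / (α + 1) := by positivity
  refine SliceSampling.deviationNorm_le hrev hr fun f hf hcent => ?_
  obtain ⟨M, hM0, hM⟩ := hf.bounded
  set r := α / (α + 1)
  -- The first step only creates the Lipschitz constant `2 * M`; contraction starts with the second,
  -- hence the shift between `n` and `n + 1`.
  have hprofile (n : ℕ) : HasLipschitzProfile ν V M (r ^ n * (2 * M))
      ((markovOp (sliceKernel η₀ η₁))^[n + 1] f) := by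
    induction n with
    | zero => simpa using h.hasLipschitzProfile_markovOp hν hf hM0 hM
    | succ n ih =>
      rw [Function.iterate_succ_apply', pow_succ', mul_assoc]
      exact h.hasLipschitzProfile_markovOp_of_profile hν hM0 ih
  have hcentn (n : ℕ) : ∫ x, (markovOp (sliceKernel η₀ η₁))^[n] f x ∂ν = 0 := by
    induction n with
    | zero => exact hcent
    | succ n ih =>
      rw [Function.iterate_succ_apply',
        integral_markovOp hrev.invariant ((hf.iterate_markovOp _ n).integrable ν), ih]
  have hV := h.integrable_sq_potential hν hZ
  have hV0 : 0 ≤ ∫ x, V x ^ 2 ∂ν := integral_nonneg fun x => sq_nonneg _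
  have hf0 : 0 ≤ ∫ x, f x ^ 2 ∂ν := integral_nonneg fun x => sq_nonneg _
  -- The first summand covers `n = 0`; dividing by `r` in the second makes up for the index shift.
  refine ⟨∫ x, f x ^ 2 ∂ν + (2 * M / r) ^ 2 * ∫ x, V x ^ 2 ∂ν, fun n => ?_⟩
  cases n with
  | zero =>
    simp only [Function.iterate_zero, id_eq, pow_zero, mul_one]
    exact le_add_of_nonneg_right (by positivity)
  | succ n =>
    refine ((hprofile n).integral_sq_le (hf.iterate_markovOp _ _) (hcentn _) hV).trans ?_
    calc (r ^ n * (2 * M)) ^ 2 * ∫ x, V x ^ 2 ∂ν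
        = (2 * M / r) ^ 2 * (∫ x, V x ^ 2 ∂ν) * (r ^ 2) ^ (n + 1) := by
          field_simp
          ring
      _ ≤ _ := by
          gcongr
          exact le_add_of_nonneg_left hf0

theorem le_spectralGap [IsProbabilityMeasure ν] (h : HasExpPotential η₀ η₁ V c α C)
    (hν : ν = Z • (refMeasure η₀).withDensity fun x => ENNReal.ofReal (η₁ x)) (hZ : Z ≠ ∞) :
    ((1 / (α + 1) : ℝ) : EReal) ≤ spectralGap ν (sliceKernel η₀ η₁) := by
  have hα := h.α_pos
  have hle := EReal.coe_ennreal_le_coe_ennreal_iff.2 (h.deviationNorm_le hν hZ)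
  rw [EReal.coe_ennreal_ofReal, max_eq_left (by positivity)] at hle
  have heq : ((1 / (α + 1) : ℝ) : EReal) = 1 - ((α / (α + 1) : ℝ) : EReal) := by
    rw [← EReal.coe_one, ← EReal.coe_sub]
    congr 1
    field_simp
    ring
  rw [heq]
  exact EReal.sub_le_sub le_rfl hle

end HasExpPotential

end Gap

/-! ### Homogeneous potentials: polar and uniform slice sampling -/

section Target

variable {d : ℕ} {η₀ η₁ V ρ : EuclideanSpace ℝ (Fin d) → ℝ} {c α : ℝ}
  {ν : Measure (EuclideanSpace ℝ (Fin d))}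

/-- In `ℝ≥0∞` both `0 / 0` and `∞ / ∞` are `0`, which contradicts total mass `1`. -/
lemma HasUnnormalizedDensity.lintegral_ne [IsProbabilityMeasure ν]
    (h : HasUnnormalizedDensity ν ρ) :
    ∫⁻ x, ENNReal.ofReal (ρ x) ≠ 0 ∧ ∫⁻ x, ENNReal.ofReal (ρ x) ≠ ∞ := by
  have h1 := h.apply_eq Set.univ MeasurableSet.univ
  rw [measure_univ, setLIntegral_univ] at h1
  constructor <;> intro h0 <;> simp [h0] at h1

lemma HasUnnormalizedDensity.eq_smul_withDensity (h : HasUnnormalizedDensity ν ρ) :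
    ν = (∫⁻ x, ENNReal.ofReal (ρ x))⁻¹ • volume.withDensity fun x => ENNReal.ofReal (ρ x) := by
  ext A hA
  rw [h.apply_eq A hA, Measure.smul_apply, withDensity_apply _ hA, smul_eq_mul, mul_comm,
    div_eq_mul_inv]

/-- A potential whose sublevel masses scale like `w ^ α` yields invariance and the spectral gap
bound `1 / (α + 1)` for the slice sampling kernel. -/
theorem invariant_and_le_spectralGap_of_scaling [IsProbabilityMeasure ν]
    (hν : HasUnnormalizedDensity ν ρ) (hη₀ : Measurable η₀) (hη₀0 : ∀ x, 0 ≤ η₀ x)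
    (hη₁ : Measurable η₁) (hV : Measurable V) (hc : 0 < c) (hα : 0 < α)
    (hρ : ∀ᵐ x, ρ x = η₀ x * η₁ x) (hη₁V : ∀ᵐ x, η₁ x = c * Real.exp (-V x))
    (hscale : ∀ w, 0 < w → refMeasure η₀ {x | V x < w}
      = ENNReal.ofReal (w ^ α) * refMeasure η₀ {x | V x < 1}) :
    (sliceKernel η₀ η₁).Invariant ν ∧
      ((1 / (α + 1) : ℝ) : EReal) ≤ spectralGap ν (sliceKernel η₀ η₁) := by
  obtain ⟨hI0, hItop⟩ := hν.lintegral_ne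
  have hdens : volume.withDensity (fun x => ENNReal.ofReal (ρ x))
      = (refMeasure η₀).withDensity fun x => ENNReal.ofReal (η₁ x) := by
    rw [refMeasure, ← withDensity_mul _ hη₀.ennreal_ofReal hη₁.ennreal_ofReal]
    refine withDensity_congr_ae ?_
    filter_upwards [hρ] with x hx
    rw [hx, ENNReal.ofReal_mul (hη₀0 x)]
    rfl
  have hI : ∫⁻ x, ENNReal.ofReal (η₁ x) ∂(refMeasure η₀) = ∫⁻ x, ENNReal.ofReal (ρ x) := by
    rw [← setLIntegral_univ, ← withDensity_apply _ MeasurableSet.univ, ← hdens,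
      withDensity_apply _ MeasurableSet.univ, setLIntegral_univ]
  have hV1 : MeasurableSet {x | V x < 1} := measurableSet_lt hV measurable_const
  have hη₁V' : ∀ᵐ x ∂(refMeasure η₀), η₁ x = c * Real.exp (-V x) :=
    (withDensity_absolutelyContinuous _ _).ae_le hη₁V
  -- By scaling, a null unit sublevel set would make all sublevel sets null, and they exhaust the
  -- space.
  have hC0 : refMeasure η₀ {x | V x < 1} ≠ 0 := by
    intro h0
    refine hI0 ?_
    have huniv : refMeasure η₀ Set.univ = 0 := by
      refine measure_mono_null (t := ⋃ n : ℕ, {x | V x < (n + 1 : ℕ)}) (fun x _ => ?_)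
        (measure_iUnion_null fun n => ?_)
      · obtain ⟨n, hn⟩ := exists_nat_gt (V x)
        exact Set.mem_iUnion.2 ⟨n, hn.trans (by exact_mod_cast n.lt_succ_self)⟩
      · rw [hscale _ (by positivity), h0, mul_zero]
    rw [← hI, Measure.measure_univ_eq_zero.1 huniv, lintegral_zero_measure]
  -- On `{V < 1}` the factor `η₁` is at least `c * exp (-1)`, so integrability of `ρ` bounds the
  -- mass.
  have hCtop : refMeasure η₀ {x | V x < 1} ≠ ∞ := by
    have hle : ENNReal.ofReal (c * Real.exp (-1)) * refMeasure η₀ {x | V x < 1}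
        ≤ ∫⁻ x, ENNReal.ofReal (ρ x) := by
      rw [← setLIntegral_const, ← hI]
      refine (lintegral_mono_ae ?_).trans (setLIntegral_le_lintegral _ _)
      filter_upwards [ae_restrict_mem hV1, ae_restrict_of_ae hη₁V'] with x hx hx'
      have hx1 : V x < 1 := hx
      rw [hx']
      gcongr
    intro htop
    have hpos := mul_pos hc (Real.exp_pos (-1))
    rw [htop, ENNReal.mul_top (by simpa using hpos)] at hle
    exact hItop (top_le_iff.1 hle)
  have hpot : HasExpPotential η₀ η₁ V c α (refMeasure η₀ {x | V x < 1}) :=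
    ⟨hη₀, hη₁, hV, hc, hα, hC0, hCtop, fun w hw => by rw [hscale w hw, mul_comm], hη₁V'⟩
  have hνeq := hν.eq_smul_withDensity
  rw [hdens] at hνeq
  exact ⟨(hpot.isReversible hνeq).invariant, hpot.le_spectralGap hνeq (ENNReal.inv_ne_top.2 hI0)⟩

/-- The measure with density `‖x‖ ^ (k - d)` is homogeneous of degree `k`. -/
lemma refMeasure_norm_rpow_preimage_smul (k : ℝ) {s : ℝ} (hs : 0 < s)
    {A : Set (EuclideanSpace ℝ (Fin d))} (hA : MeasurableSet A) :
    refMeasure (fun x : EuclideanSpace ℝ (Fin d) => ‖x‖ ^ (k - d)) ((s • ·) ⁻¹' A)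
      = ENNReal.ofReal (s ^ (-k)) * refMeasure (fun x => ‖x‖ ^ (k - d)) A := by
  have hsm : Measurable fun x : EuclideanSpace ℝ (Fin d) => s • x := measurable_const_smul s
  have hF : Measurable (A.indicator fun y : EuclideanSpace ℝ (Fin d) =>
      ENNReal.ofReal (s ^ (d - k)) * ENNReal.ofReal (‖y‖ ^ (k - d))) :=
    Measurable.indicator (by fun_prop) hA
  rw [refMeasure, withDensity_apply _ (hsm hA), withDensity_apply _ hA]
  calc ∫⁻ x in (s • ·) ⁻¹' A, ENNReal.ofReal (‖x‖ ^ (k - d))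
      = ∫⁻ x, A.indicator (fun y => ENNReal.ofReal (s ^ (d - k))
          * ENNReal.ofReal (‖y‖ ^ (k - d))) (s • x) := by
        rw [← lintegral_indicator (hsm hA)]
        refine lintegral_congr fun x => ?_
        by_cases hx : s • x ∈ A
        · rw [Set.indicator_of_mem (show x ∈ (s • ·) ⁻¹' A from hx), Set.indicator_of_mem hx,
            norm_smul, Real.norm_of_nonneg hs.le, Real.mul_rpow hs.le (norm_nonneg _),
            ← ENNReal.ofReal_mul (Real.rpow_nonneg hs.le _), ← mul_assoc, ← Real.rpow_add hs]
          simp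
        · rw [Set.indicator_of_notMem (show x ∉ (s • ·) ⁻¹' A from hx),
            Set.indicator_of_notMem hx]
    -- The Jacobian `s ^ (-d)` combines with `s ^ (d - k)` from the weight.
    _ = ENNReal.ofReal (s ^ (-k)) * ∫⁻ x in A, ENNReal.ofReal (‖x‖ ^ (k - d)) := by
        rw [← lintegral_map hF hsm, Measure.map_addHaar_smul _ hs.ne', lintegral_smul_measure,
          lintegral_indicator hA, lintegral_const_mul _ (by fun_prop), smul_eq_mul, ← mul_assoc,
          ← ENNReal.ofReal_mul (abs_nonneg _), finrank_euclideanSpace_fin,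
          abs_of_pos (by positivity), ← Real.rpow_natCast, ← Real.rpow_neg hs.le,
          ← Real.rpow_add hs]
        congr 3
        ring

/-- Sublevel sets of a potential that is homogeneous of degree `m`, in the measure with density
`‖x‖ ^ (k - d)`. -/
lemma refMeasure_norm_rpow_sublevel (hd : 0 < d) {k m : ℝ} (hm : 0 < m) (hV : Measurable V)
    (hhom : ∀ (s : ℝ) x, 0 < s → x ≠ 0 → V (s • x) = s ^ m * V x) {w : ℝ} (hw : 0 < w) :
    refMeasure (fun x => ‖x‖ ^ (k - d)) {x | V x < w}
      = ENNReal.ofReal (w ^ (k / m)) * refMeasure (fun x => ‖x‖ ^ (k - d)) {x | V x < 1} := by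
  have hne : Nonempty (Fin d) := ⟨⟨0, hd⟩⟩
  -- Dilation by `w ^ (-1 / m)` carries `{V < w}` to `{V < 1}`, up to the origin.
  have h := refMeasure_norm_rpow_preimage_smul k (Real.rpow_pos_of_pos hw (-(1 / m)))
    (measurableSet_lt hV (measurable_const (a := (1 : ℝ))))
  rw [← Real.rpow_mul hw.le, show -(1 / m) * -k = k / m by ring] at h
  rw [← h]
  refine measure_congr ?_
  have hx0 : ∀ᵐ x ∂(refMeasure fun x : EuclideanSpace ℝ (Fin d) => ‖x‖ ^ (k - d)), x ≠ 0 :=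
    (withDensity_absolutelyContinuous _ _).ae_le (Measure.ae_ne volume 0)
  filter_upwards [hx0] with x hx
  refine propext ?_
  change V x < w ↔ V (w ^ (-(1 / m)) • x) < 1
  rw [hhom _ _ (Real.rpow_pos_of_pos hw _) hx, ← Real.rpow_mul hw.le,
    show -(1 / m) * m = -1 by field_simp, Real.rpow_neg_one, inv_mul_lt_iff₀ hw, mul_one]

/-- Polar slice sampling for a target that decays exponentially along rays. -/
theorem polarSliceKernel_invariant_and_le_spectralGap (hd : 0 < d) {k m : ℝ} (hk : 0 < k)
    (hm : 0 < m) {χ : Metric.sphere (0 : EuclideanSpace ℝ (Fin d)) 1 → ℝ} [IsProbabilityMeasure ν]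
    (hν : HasUnnormalizedDensity ν ρ)
    (hρ : ∀ (r : ℝ) (θ : Metric.sphere (0 : EuclideanSpace ℝ (Fin d)) 1), 0 < r →
      ρ (r • (θ : EuclideanSpace ℝ (Fin d))) = r ^ (k - (d : ℝ)) * Real.exp (-(χ θ * r ^ m))) :
    (polarSliceKernel k ρ).Invariant ν ∧
      ((m / (k + m) : ℝ) : EReal) ≤ spectralGap ν (polarSliceKernel k ρ) := by
  have hne : Nonempty (Fin d) := ⟨⟨0, hd⟩⟩
  have hη₁ : Measurable fun x : EuclideanSpace ℝ (Fin d) => ‖x‖ ^ (d - k) * ρ x := by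
    have := hν.measurable
    fun_prop
  have hray (r : ℝ) (θ : Metric.sphere (0 : EuclideanSpace ℝ (Fin d)) 1) (hr : 0 < r) :
      ‖r • (θ : EuclideanSpace ℝ (Fin d))‖ ^ (d - k) * ρ (r • (θ : EuclideanSpace ℝ (Fin d)))
        = Real.exp (-(χ θ * r ^ m)) := by
    rw [hρ r θ hr, norm_smul, norm_eq_of_mem_sphere, mul_one, Real.norm_of_nonneg hr.le,
      ← mul_assoc, ← Real.rpow_add hr]
    simp
  have hpolar (x : EuclideanSpace ℝ (Fin d)) (hx : x ≠ 0) :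
      ∃ (r : ℝ) (θ : Metric.sphere (0 : EuclideanSpace ℝ (Fin d)) 1), 0 < r ∧ x = r • θ.1 := by
    have hx' := norm_pos_iff.2 hx
    refine ⟨‖x‖, ⟨‖x‖⁻¹ • x, ?_⟩, hx', ?_⟩
    · simp [norm_smul, hx'.ne']
    · simp [smul_smul, hx'.ne']
  have hae0 : ∀ᵐ x : EuclideanSpace ℝ (Fin d), x ≠ 0 := Measure.ae_ne volume 0
  -- The potential is `-log η₁`, which equals `χ θ * r ^ m` at `r • θ`.
  have hhom : ∀ (s : ℝ) (x : EuclideanSpace ℝ (Fin d)), 0 < s → x ≠ 0 →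
      -Real.log (‖s • x‖ ^ (d - k) * ρ (s • x)) = s ^ m * -Real.log (‖x‖ ^ (d - k) * ρ x) := by
    intro s x hs hx
    obtain ⟨r, θ, hr, rfl⟩ := hpolar x hx
    rw [smul_smul, hray _ θ (mul_pos hs hr), hray r θ hr, Real.log_exp, Real.log_exp,
      Real.mul_rpow hs.le hr.le]
    ring
  have hV := hη₁.log.neg
  have hmain := invariant_and_le_spectralGap_of_scaling (c := 1) (α := k / m) hν
    (η₀ := fun x => ‖x‖ ^ (k - d)) (by fun_prop) (fun x => Real.rpow_nonneg (norm_nonneg _) _) hη₁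
    hV one_pos (by positivity) ?_ ?_
    (fun w hw => refMeasure_norm_rpow_sublevel hd hm hV hhom hw)
  · rw [show 1 / (k / m + 1) = m / (k + m) by field_simp] at hmain
    exact hmain
  · filter_upwards [hae0] with x hx
    rw [← mul_assoc, ← Real.rpow_add (norm_pos_iff.2 hx)]
    simp
  · filter_upwards [hae0] with x hx
    obtain ⟨r, θ, hr, rfl⟩ := hpolar x hx
    simp only [Pi.neg_apply, hray r θ hr, Real.log_exp, neg_neg, one_mul]

/-- Uniform slice sampling for a target whose negative logarithm is, up to constants, a function
that is homogeneous of degree `m` after centring at `a`. -/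
theorem uniformSliceKernel_invariant_and_le_spectralGap (hd : 0 < d) {m : ℝ} (hm : 0 < m)
    (hc : 0 < c) {a : EuclideanSpace ℝ (Fin d)} {q : EuclideanSpace ℝ (Fin d) → ℝ}
    (hq : Measurable q) (hhom : ∀ (s : ℝ) x, 0 < s → x ≠ 0 → q (s • x) = s ^ m * q x)
    [IsProbabilityMeasure ν] (hν : HasUnnormalizedDensity ν ρ)
    (hρ : ∀ x, ρ x = c * Real.exp (-q (x - a))) :
    (uniformSliceKernel ρ).Invariant ν ∧
      ((m / (d + m) : ℝ) : EReal) ≤ spectralGap ν (uniformSliceKernel ρ) := by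
  have hd' : (0 : ℝ) < d := by exact_mod_cast hd
  have hone : refMeasure (fun _ : EuclideanSpace ℝ (Fin d) => (1 : ℝ)) = volume := by
    simp [refMeasure]
  -- Lebesgue measure is the case `k = d` of the weight, so the polar scaling lemma applies to
  -- uniform slice sampling.
  have hone' : refMeasure (fun x : EuclideanSpace ℝ (Fin d) => ‖x‖ ^ ((d : ℝ) - d)) = volume := by
    simp [refMeasure]
  have hshift (w : ℝ) :
      volume {x : EuclideanSpace ℝ (Fin d) | q (x - a) < w} = volume {x | q x < w} :=
    (measurePreserving_sub_right volume a).measure_preimage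
      (measurableSet_lt hq measurable_const).nullMeasurableSet
  have hmain := invariant_and_le_spectralGap_of_scaling (c := c) (α := d / m) hν
    (η₀ := fun _ => 1) (V := fun x => q (x - a)) measurable_const (fun x => zero_le_one)
    hν.measurable (by fun_prop) hc (by positivity) (.of_forall fun x => (one_mul _).symm)
    (.of_forall hρ) fun w hw => by
      have := refMeasure_norm_rpow_sublevel (k := d) hd hm hq hhom hw
      rw [hone'] at this
      rw [hone, hshift, hshift, this]
  rw [show 1 / ((d : ℝ) / m + 1) = m / (d + m) by field_simp] at hmain
  exact hmain

end Target

/-! ### Densities of Gaussian measures -/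

section Gaussian

variable {d : ℕ}

open scoped RealInnerProductSpace in
/-- The standard Gaussian measure has a density proportional to `exp (-‖x‖ ^ 2 / 2)`. -/
lemma stdGaussian_eq_smul_withDensity :
    ∃ K : ℝ≥0∞, stdGaussian (EuclideanSpace ℝ (Fin d))
      = K • volume.withDensity fun x => ENNReal.ofReal (Real.exp (-(‖x‖ ^ 2 / 2))) := by
  have hb : (0 : ℝ) < (1 / 2 : ℂ).re := by norm_num
  have hform (t x : EuclideanSpace ℝ (Fin d)) :
      (-(1 / 2 : ℂ) * ‖x‖ ^ 2 + Complex.I * ⟪t, x⟫)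
        = ((-(‖x‖ ^ 2 / 2) : ℝ) : ℂ) + ⟪x, t⟫ * Complex.I := by
    rw [real_inner_comm]
    push_cast
    ring
  have hval (t : EuclideanSpace ℝ (Fin d)) :=
    GaussianFourier.integral_cexp_neg_mul_sq_norm_add hb Complex.I t
  set κ : ℂ := (Real.pi / (1 / 2 : ℂ)) ^ (Module.finrank ℝ (EuclideanSpace ℝ (Fin d)) / 2 : ℂ)
    with hκ
  have hκ0 : κ ≠ 0 := by
    rw [hκ, Complex.cpow_ne_zero_iff]
    left
    simp [Real.pi_ne_zero]
  set w : EuclideanSpace ℝ (Fin d) → ℝ := fun x => Real.exp (-(‖x‖ ^ 2 / 2)) with hw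
  have hwm : Measurable w := by fun_prop
  have hint : Integrable w := by
    have h := (GaussianFourier.integrable_cexp_neg_mul_sq_norm_add hb Complex.I
      (0 : EuclideanSpace ℝ (Fin d))).re
    refine h.congr (.of_forall fun x => ?_)
    simp only [hform, hw]
    rw [inner_zero_right, Complex.ofReal_zero, zero_mul, add_zero, ← Complex.ofReal_exp]
    rfl
  have hI : ((∫ x, w x : ℝ) : ℂ) = κ := by
    have h := hval 0
    simp only [hform] at h
    rw [← integral_complex_ofReal]
    simpa [hw] using h
  have hIpos : 0 < ∫ x, w x := by
    refine (integral_nonneg fun x => (Real.exp_pos _).le).lt_of_ne fun h0 => hκ0 ?_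
    rw [← hI, ← h0, Complex.ofReal_zero]
  refine ⟨ENNReal.ofReal (∫ x, w x)⁻¹, ?_⟩
  have hfin : IsFiniteMeasure (volume.withDensity fun x => ENNReal.ofReal (w x)) :=
    isFiniteMeasure_withDensity_ofReal hint.2
  have hfin' : IsFiniteMeasure (ENNReal.ofReal (∫ x, w x)⁻¹ •
      volume.withDensity fun x => ENNReal.ofReal (w x)) :=
    Measure.smul_finite _ ENNReal.ofReal_ne_top
  -- The Fourier transform of `exp (-‖x‖ ^ 2 / 2)` is `κ * exp (-‖t‖ ^ 2 / 2)`, and `κ` is its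
  -- integral, so normalising leaves the standard Gaussian characteristic function.
  refine Measure.ext_of_charFun (E := EuclideanSpace ℝ (Fin d)) ?_
  ext t
  rw [charFun_stdGaussian, charFun_apply, integral_smul_measure,
    integral_withDensity_eq_integral_toReal_smul hwm.ennreal_ofReal (by simp)]
  have hinteg : ∫ x, (ENNReal.ofReal (w x)).toReal • Complex.exp (⟪x, t⟫ * Complex.I)
      = κ * Complex.exp (-‖t‖ ^ 2 / 2) := by
    have h := hval t
    simp only [hform, Complex.exp_add, ← Complex.ofReal_exp] at h
    rw [show Complex.I ^ 2 * (‖t‖ : ℂ) ^ 2 / (4 * (1 / 2)) = -‖t‖ ^ 2 / 2 by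
      rw [Complex.I_sq]; ring] at h
    rw [← h]
    refine integral_congr_ae (.of_forall fun x => ?_)
    simp only [Complex.real_smul]
    rw [ENNReal.toReal_ofReal (Real.exp_pos _).le]
  rw [hinteg, ENNReal.toReal_ofReal (inv_nonneg.2 hIpos.le), Complex.real_smul, ← hI,
    Complex.ofReal_inv, inv_mul_cancel_left₀ (by exact_mod_cast hIpos.ne')]

open scoped MatrixOrder in
/-- The multivariate Gaussian measure with positive definite covariance matrix `S` has a density
proportional to `exp (-(x - a)ᵀ S⁻¹ (x - a) / 2)`. -/
lemma hasUnnormalizedDensity_multivariateGaussian (a : EuclideanSpace ℝ (Fin d))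
    {S : Matrix (Fin d) (Fin d) ℝ} (hS : S.PosDef) {c : ℝ} (hc : 0 < c)
    {ρ : EuclideanSpace ℝ (Fin d) → ℝ}
    (hρ : ∀ x, ρ x = c * Real.exp (-(1 / 2) *
      ((x - a).ofLp ⬝ᵥ (S⁻¹.mulVec (x - a).ofLp)))) :
    HasUnnormalizedDensity (multivariateGaussian a S) ρ := by
  have hρm : Measurable ρ := by
    rw [funext hρ]
    simp only [dotProduct, Matrix.mulVec]
    fun_prop
  refine ⟨hρm, fun x => by rw [hρ]; positivity, ?_⟩
  -- The Gaussian is the image of the standard one under `x ↦ a + B x`, and `B S⁻¹ B = 1` turns the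
  -- quadratic form into `‖x‖ ^ 2`.
  set B := CFC.sqrt S with hB
  have hBB : B * B = S := CFC.sqrt_mul_sqrt_self S hS.posSemidef.nonneg
  have hBt : B.transpose = B := by
    have := (Matrix.nonneg_iff_posSemidef.1 (CFC.sqrt_nonneg S)).isHermitian
    rwa [Matrix.IsHermitian, Matrix.conjTranspose_eq_transpose_of_trivial] at this
  have hBdet : B.det ≠ 0 := fun h => hS.det_pos.ne' (by rw [← hBB, Matrix.det_mul, h, zero_mul])
  have hBunit : IsUnit B.det := isUnit_iff_ne_zero.2 hBdet
  have hcancel : B * S⁻¹ * B = 1 := by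
    rw [← hBB, Matrix.mul_inv_rev, ← Matrix.mul_assoc, Matrix.mul_nonsing_inv _ hBunit,
      Matrix.one_mul, Matrix.nonsing_inv_mul _ hBunit]
  set T := Matrix.toEuclideanCLM (𝕜 := ℝ) B with hT
  have hquad (x : EuclideanSpace ℝ (Fin d)) : ρ (a + T x) = c * Real.exp (-(‖x‖ ^ 2 / 2)) := by
    rw [hρ, add_sub_cancel_left, hT, Matrix.ofLp_toEuclideanCLM, Matrix.mulVec_mulVec,
      Matrix.dotProduct_mulVec, Matrix.vecMul_mulVec, hBt,
      ← Matrix.mul_assoc, hcancel, Matrix.vecMul_one, EuclideanSpace.real_norm_sq_eq]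
    simp only [dotProduct, ← pow_two]
    ring_nf
  obtain ⟨K, hK⟩ := stdGaussian_eq_smul_withDensity (d := d)
  have hTm : Measurable fun x => a + T x := by fun_prop
  -- The value of the Jacobian constant is irrelevant: total mass `1` fixes the product of all
  -- constants at the end.
  have hTvol : ∃ K' : ℝ≥0∞, (volume : Measure (EuclideanSpace ℝ (Fin d))).map (fun x => a + T x)
      = K' • volume := by
    have hdet : LinearMap.det (T : EuclideanSpace ℝ (Fin d) →ₗ[ℝ] EuclideanSpace ℝ (Fin d)) ≠ 0 := by
      rw [hT, Matrix.coe_toEuclideanCLM_eq_toEuclideanLin, Matrix.toEuclideanLin_eq_toLin_orthonormal,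
        LinearMap.det_toLin]
      exact hBdet
    refine ⟨ENNReal.ofReal |(LinearMap.det
      (T : EuclideanSpace ℝ (Fin d) →ₗ[ℝ] EuclideanSpace ℝ (Fin d)))⁻¹|, ?_⟩
    rw [show (fun x => a + T x) = (a + ·) ∘ T from rfl,
      ← Measure.map_map (measurable_const_add a) T.continuous.measurable]
    have h := Measure.map_linearMap_addHaar_eq_smul_addHaar
      (volume : Measure (EuclideanSpace ℝ (Fin d))) hdet
    rw [ContinuousLinearMap.coe_coe] at h
    rw [h, Measure.map_smul, map_add_left_eq_self]
  obtain ⟨K', hK'⟩ := hTvol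
  have hρT : Measurable fun x => ENNReal.ofReal (ρ (a + T x)) := (hρm.comp hTm).ennreal_ofReal
  have hmul (A : Set (EuclideanSpace ℝ (Fin d))) (hA : MeasurableSet A) :
      multivariateGaussian a S A
        = K * (ENNReal.ofReal c)⁻¹ * K' * ∫⁻ x in A, ENNReal.ofReal (ρ x) := by
    rw [multivariateGaussian, Measure.map_apply hTm hA, hK, Measure.smul_apply,
      withDensity_apply _ (hTm hA), smul_eq_mul, mul_assoc, mul_assoc, ← smul_eq_mul K',
      ← lintegral_smul_measure, ← Measure.restrict_smul, ← hK',
      setLIntegral_map hA hρm.ennreal_ofReal hTm,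
      ← lintegral_const_mul _ hρT]
    congr 1
    refine lintegral_congr fun x => ?_
    rw [hquad, ENNReal.ofReal_mul hc.le, ← mul_assoc,
      ENNReal.inv_mul_cancel (by simpa using hc) ENNReal.ofReal_ne_top, one_mul]
  intro A hA
  have huniv := hmul Set.univ MeasurableSet.univ
  rw [measure_univ, setLIntegral_univ] at huniv
  rw [hmul A hA, ENNReal.eq_inv_of_mul_eq_one_left huniv.symm, mul_comm, div_eq_mul_inv]

end Gaussian

end SliceSampling

theorem theorem3p6 (d : ℕ) (hd : 0 < d) :
    (∀ (k m : ℝ), 0 < k → 0 < m →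
      ∀ (χ : Metric.sphere (0 : EuclideanSpace ℝ (Fin d)) 1 → ℝ), Measurable χ → (∀ θ, 0 < χ θ) →
      ∀ (π : Measure (EuclideanSpace ℝ (Fin d))) [IsProbabilityMeasure π]
        (ρ : EuclideanSpace ℝ (Fin d) → ℝ),
        SliceSampling.HasUnnormalizedDensity π ρ →
        (∀ (r : ℝ) (θ : Metric.sphere (0 : EuclideanSpace ℝ (Fin d)) 1), 0 < r →
          ρ (r • (θ : EuclideanSpace ℝ (Fin d))) =
            r ^ (k - (d : ℝ)) * Real.exp (-(χ θ * r ^ m))) →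
        (SliceSampling.polarSliceKernel k ρ).Invariant π ∧
        ((m / (k + m) : ℝ) : EReal) ≤
          SliceSampling.spectralGap π (SliceSampling.polarSliceKernel k ρ)) ∧
    (∀ (a : EuclideanSpace ℝ (Fin d)) (S : Matrix (Fin d) (Fin d) ℝ), S.PosDef →
      ∀ (c : ℝ), 0 < c → ∀ (ρ : EuclideanSpace ℝ (Fin d) → ℝ),
        (∀ x, ρ x = c * Real.exp (-(1 / 2) *
          ((x - a).ofLp ⬝ᵥ (S⁻¹.mulVec (x - a).ofLp)))) →
        SliceSampling.HasUnnormalizedDensity (multivariateGaussian a S) ρ ∧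
        (SliceSampling.uniformSliceKernel ρ).Invariant (multivariateGaussian a S) ∧
        ((2 / ((d : ℝ) + 2) : ℝ) : EReal) ≤
          SliceSampling.spectralGap (multivariateGaussian a S)
            (SliceSampling.uniformSliceKernel ρ)) := by
  refine ⟨fun k m hk hm χ _ _ π _ ρ hπ hρ =>
    SliceSampling.polarSliceKernel_invariant_and_le_spectralGap hd hk hm hπ hρ,
    fun a S hS c hc ρ hρ => ?_⟩
  have hdens := SliceSampling.hasUnnormalizedDensity_multivariateGaussian a hS hc hρ
  -- The quadratic form is homogeneous of degree `m = 2`, so `m / (d + m)` is the claimed bound.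
  refine ⟨hdens, SliceSampling.uniformSliceKernel_invariant_and_le_spectralGap hd two_pos hc
    (a := a) (q := fun x => 1 / 2 * (x.ofLp ⬝ᵥ (S⁻¹.mulVec x.ofLp))) ?_ ?_ hdens ?_⟩
  · simp only [dotProduct, Matrix.mulVec]
    fun_prop
  · intro s x _ _
    simp only [WithLp.ofLp_smul, Matrix.mulVec_smul, smul_dotProduct, dotProduct_smul, smul_eq_mul,
      Real.rpow_two]
    ring
  · intro x
    rw [hρ]
    simp only [neg_mul]
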